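/- All systems are finite-dimensional of nonzero dimension. A dynamical system $A=(A_0,A_1)$ consists of an input system $A_0$ and an output system $A_1$; $\mathcal L^A$ is the space of linear maps $\mathcal B(\mathcal H^{A_0})\to\mathcal B(\mathcal H^{A_1})$, and a channel on $A$ is a completely positive trace-preserving (CPTP) element of $\mathcal L^A$. A superchannel from $A$ to $B$ is a linear map $\Theta:\mathcal L^A\to\mathcal L^B$ that sends trace-preserving maps to trace-preserving maps and for which $\mathbb 1^C\otimes\Theta$ sends completely positive maps to completely positive maps, for every system $C=(C_0,C_1)$. For a channel $\Omega:\mathcal B(\mathcal H^{A_0R_0})\to\mathcal B(\mathcal H^{A_1R_1})$ with normalized Choi matrix $\omega^{AR}=\frac{1}{d_{A_0}d_{R_0}}\sum_{i,j}|i\rangle\langle j|^{A_0R_0}\otimes\Omega(|i\rangle\langle j|)$, the extended conditional min-entropy is $$H_{\min}^{\rm ext}(R|A)_\Omega=-\log_2\min\left\{{\rm Tr}\,\gamma^{AR_0}\;:\;\gamma^{AR_0}\otimes I^{R_1}\ge\omega^{AR},\ \gamma^{A_0R_0}=u^{A_0}\otimes\gamma^{R_0}\right\},$$ where $u^{A_0}=I^{A_0}/d_{A_0}$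 and omitted superscripts denote partial traces. For a tripartite channel $\Lambda^{ABR}$, $H_{\min}^{\rm ext}(R|A)_\Lambda$ is evaluated on the marginal $X^{A_0R_0}\mapsto{\rm Tr}_{B_1}\Lambda^{ABR}(X\otimes\tau^{B_0})$ for a density matrix $\tau^{B_0}$, and $H_{\min}^{\rm ext}(R|B)_\Lambda$ on the marginal obtained in the same way by feeding a density matrix $\sigma^{A_0}$ into $A_0$ and tracing out $A_1$. Let $R$ be a copy of $B$, i.e. a system with the same input and output dimensions. (1) Let $n\ge1$, let $\Psi_1,\dots,\Psi_n$ be channels on $A$ and $\Phi_1,\dots,\Phi_n$ channels on $B$. For every choice of the density matrices $\sigma^{A_0},\tau^{B_0}$ used in the marginals, there is a superchannel $\Theta$ from $A$ to $B$ with $\Phi_j=\Theta[\Psi_j]$ for all $j=1,\dots,n$ if and only if for all channels $\Lambda_1,\dots,\Lambda_n$ on $R$ the tripartite channel $$\Lambda^{ABR}=\frac1n\sum_{j=1}^n\Psi_j^A\otimes\Phi_j^B\otimes\Lambda_j^R$$ satisfies $H_{\min}^{\rm ext}(R|A)_\Lambda\le H_{\min}^{\rm ext}(R|B)_\Lambda$.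 (2) For $n=2$ this gives a complete family of channel divergences. For channels $\Lambda_1,\Lambda_2$ on $R$ and channels $\Psi_1,\Psi_2$ on any system $A$, put $C_\Lambda(\Psi_1\|\Psi_2)=-H_{\min}^{\rm ext}(R|A)$, evaluated on $\frac12(\Psi_1\otimes\Lambda_1+\Psi_2\otimes\Lambda_2)$. Then $C_\Lambda(\Theta[\Psi_1]\|\Theta[\Psi_2])\le C_\Lambda(\Psi_1\|\Psi_2)$ for every superchannel $\Theta$ from $A$ to any system; and for channels $\Psi_1,\Psi_2$ on $A$ and $\Phi_1,\Phi_2$ on $B$, there is a superchannel $\Theta$ from $A$ to $B$ with $\Phi_1=\Theta[\Psi_1]$ and $\Phi_2=\Theta[\Psi_2]$ if and only if $C_\Lambda(\Phi_1\|\Phi_2)\le C_\Lambda(\Psi_1\|\Psi_2)$ for all channels $\Lambda_1,\Lambda_2$ on $R$. -/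

import Mathlib

open scoped Kronecker ComplexOrder

noncomputable section

/-- `B(H)` for a finite-dimensional Hilbert space `H` with a fixed orthonormal basis labelled
by `d`. -/
abbrev Op (d : Type*) := Matrix d d ℂ

/-- The space `L^A` of all linear maps `B(H^{A₀}) → B(H^{A₁})`, where `A = (A₀, A₁)`. -/
abbrev LinMap (a0 a1 : Type*) := Op a0 →ₗ[ℂ] Op a1

/-- The space of all supermaps, i.e. linear maps `L^A → L^B`. -/
abbrev SuperMap (a0 a1 b0 b1 : Type*) := LinMap a0 a1 →ₗ[ℂ] LinMap b0 b1

/-- The partial trace over the second factor. -/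
def ptraceRight {p q : Type*} [Fintype q] (X : Op (p × q)) : Op p :=
  Matrix.of fun i j => ∑ k, X (i, k) (j, k)

/-- The partial trace over the first factor. -/
def ptraceLeft {p q : Type*} [Fintype p] (X : Op (p × q)) : Op q :=
  Matrix.of fun i j => ∑ k, X (k, i) (k, j)

/-- The `(i, j)` block of an operator on a composite system `p × q`, an operator on `q`. -/
def block {p q : Type*} (X : Op (p × q)) (i j : p) : Op q :=
  Matrix.of fun k l => X (i, k) (j, l)

/-! ### Channels -/

/-- Complete positivity: `id_k ⊗ Ψ`, which acts on a block matrix by applying `Ψ` to each block,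
preserves positive semidefiniteness for every `k`. -/
def IsCP {a0 a1 : Type*} (Ψ : LinMap a0 a1) : Prop :=
  ∀ (k : ℕ) (X : Op (Fin k × a0)), X.PosSemidef →
    (Matrix.of fun p q : Fin k × a1 => Ψ (block X p.1 q.1) p.2 q.2).PosSemidef

/-- Trace preservation. -/
def IsTP {a0 a1 : Type*} [Fintype a0] [Fintype a1] (Ψ : LinMap a0 a1) : Prop :=
  ∀ X : Op a0, (Ψ X).trace = X.trace

/-- Quantum channels: completely positive trace preserving maps. -/
def IsChannel {a0 a1 : Type*} [Fintype a0] [Fintype a1] (Ψ : LinMap a0 a1) : Prop :=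
  IsCP Ψ ∧ IsTP Ψ

/-- Density matrices. -/
def IsDensity {d : Type*} [Fintype d] (ρ : Op d) : Prop :=
  ρ.PosSemidef ∧ ρ.trace = 1

/-- The tensor product `Ψ ⊗ Φ` of two linear maps, determined by
`(Ψ ⊗ Φ)(X ⊗ Y) = Ψ(X) ⊗ Φ(Y)`. -/
def tensorMap {a0 a1 b0 b1 : Type*} [Fintype a0] [DecidableEq a0]
    (Ψ : LinMap a0 a1) (Φ : LinMap b0 b1) : LinMap (a0 × b0) (a1 × b1) where
  toFun X := ∑ i, ∑ j, Ψ (Matrix.single i j 1) ⊗ₖ Φ (block X i j)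
  map_add' X Y := by
    simp only [← Finset.sum_add_distrib]
    refine Finset.sum_congr rfl fun i _ => Finset.sum_congr rfl fun j _ => ?_
    rw [show block (X + Y) i j = block X i j + block Y i j from rfl, map_add,
      Matrix.kronecker_add]
  map_smul' c X := by
    simp only [Finset.smul_sum, RingHom.id_apply]
    refine Finset.sum_congr rfl fun i _ => Finset.sum_congr rfl fun j _ => ?_
    rw [show block (c • X) i j = c • block X i j from rfl, map_smul, Matrix.kronecker_smul]

/-! ### Superchannels -/

/-- The canonical basis element `ρ ↦ ⟨i|ρ|j⟩ |k⟩⟨l|` of `L^C`. -/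
def basisMap {c0 c1 : Type*} [DecidableEq c1] (i j : c0) (k l : c1) : LinMap c0 c1 where
  toFun ρ := ρ i j • Matrix.single k l 1
  map_add' X Y := by simp [add_smul]
  map_smul' c X := by simp [mul_smul]

/-- The component in `L^A` of `Ω ∈ L^{CA}` along the canonical basis element `basisMap i j k l`
of `L^C`: the map `ρ ↦ ⟨k| Ω(|i⟩⟨j| ⊗ ρ) |l⟩`, so that
`Ω = ∑ basisMap i j k l ⊗ component Ω i j k l`. -/
def component {c0 c1 a0 a1 : Type*} [DecidableEq c0] (Ω : LinMap (c0 × a0) (c1 × a1))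
    (i j : c0) (k l : c1) : LinMap a0 a1 where
  toFun ρ := block (Ω (Matrix.single i j 1 ⊗ₖ ρ)) k l
  map_add' X Y := by rw [Matrix.kronecker_add, map_add]; rfl
  map_smul' c X := by rw [Matrix.kronecker_smul, map_smul]; rfl

/-- The action of `𝟙^C ⊗ Θ` on `L^{CA}`, for a supermap `Θ : L^A → L^B`. -/
def idTensorSuper {c0 c1 a0 a1 b0 b1 : Type*} [Fintype c0] [DecidableEq c0]
    [Fintype c1] [DecidableEq c1] (Θ : SuperMap a0 a1 b0 b1) (Ω : LinMap (c0 × a0) (c1 × a1)) :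
    LinMap (c0 × b0) (c1 × b1) :=
  ∑ i, ∑ j, ∑ k, ∑ l, tensorMap (basisMap i j k l) (Θ (component Ω i j k l))

/-- `Θ` is completely CP preserving: `𝟙^C ⊗ Θ` sends CP maps to CP maps, for all dimensions
of `C = (C₀, C₁)`. -/
def IsCompletelyCPP {a0 a1 b0 b1 : Type*} (Θ : SuperMap a0 a1 b0 b1) : Prop :=
  ∀ (m n : ℕ) (Ω : LinMap (Fin m × a0) (Fin n × a1)), IsCP Ω → IsCP (idTensorSuper Θ Ω)

/-- `Θ` is TP preserving: it sends trace preserving maps to trace preserving maps. -/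
def IsTPP {a0 a1 b0 b1 : Type*} [Fintype a0] [Fintype a1] [Fintype b0] [Fintype b1]
    (Θ : SuperMap a0 a1 b0 b1) : Prop :=
  ∀ Ψ : LinMap a0 a1, IsTP Ψ → IsTP (Θ Ψ)

/-- Superchannels: completely CP preserving and TP preserving supermaps. -/
def IsSuperchannel {a0 a1 b0 b1 : Type*} [Fintype a0] [Fintype a1] [Fintype b0] [Fintype b1]
    (Θ : SuperMap a0 a1 b0 b1) : Prop :=
  IsCompletelyCPP Θ ∧ IsTPP Θ

/-! ### The extended conditional min-entropy -/

/-- The Choi matrix `(id ⊗ Ψ)(φ₊) = ∑ |i⟩⟨j| ⊗ Ψ(|i⟩⟨j|)`, with `φ₊` the unnormalized maximally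
entangled state. -/
def choi {a0 a1 : Type*} [Fintype a0] [DecidableEq a0] (Ψ : LinMap a0 a1) : Op (a0 × a1) :=
  ∑ i, ∑ j, Matrix.single i j (1 : ℂ) ⊗ₖ Ψ (Matrix.single i j 1)

/-- The Choi matrix `ω^{AB}` of a bipartite map, normalized by `1 / (d_{A₀} d_{B₀})`. -/
def normChoi {a0 a1 b0 b1 : Type*} [Fintype a0] [DecidableEq a0] [Fintype b0] [DecidableEq b0]
    (Ω : LinMap (a0 × b0) (a1 × b1)) : Op ((a0 × b0) × (a1 × b1)) :=
  (1 / ((Fintype.card a0 : ℂ) * (Fintype.card b0 : ℂ))) • choi Ω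

/-- The maximally mixed state. -/
def maxMixed (d : Type*) [Fintype d] [DecidableEq d] : Op d :=
  (1 / (Fintype.card d : ℂ)) • (1 : Op d)

/-- The constraints on `γ^{A B₀}` (whose factors are ordered as `A₀ B₀ A₁`):
`γ^{A B₀} ⊗ I^{B₁} ≥ ω^{AB}` and `γ^{A₀ B₀} = u^{A₀} ⊗ γ^{B₀}`. -/
def IsFeasible {a0 a1 b0 b1 : Type*} [Fintype a0] [DecidableEq a0] [Fintype a1]
    [Fintype b0] [DecidableEq b0] [DecidableEq b1]
    (Ω : LinMap (a0 × b0) (a1 × b1)) (γ : Op ((a0 × b0) × a1)) : Prop :=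
  (Matrix.reindex (Equiv.prodAssoc (a0 × b0) a1 b1) (Equiv.prodAssoc (a0 × b0) a1 b1)
      (γ ⊗ₖ (1 : Op b1)) - normChoi Ω).PosSemidef ∧
    ptraceRight γ = maxMixed a0 ⊗ₖ ptraceLeft (ptraceRight γ)

/-- The extended conditional min-entropy `H_min^ext(B|A)_Ω = - log₂ min Tr γ^{A B₀}` of a
bipartite map `Ω`, whose first factor is `A` and whose second factor is `B`. Feasible `γ` are
Hermitian, so that their traces are real; for completely positive `Ω` the traces of feasible
`γ` form a closed set that is bounded below, so that the infimum is a minimum. -/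
def hMinExt {a0 a1 b0 b1 : Type*} [Fintype a0] [DecidableEq a0] [Fintype a1] [DecidableEq a1]
    [Fintype b0] [DecidableEq b0] [DecidableEq b1]
    (Ω : LinMap (a0 × b0) (a1 × b1)) : ℝ :=
  - Real.logb 2 (sInf {t : ℝ | ∃ γ : Op ((a0 × b0) × a1), IsFeasible Ω γ ∧ t = γ.trace.re})

/-! ### Tripartite maps and their bipartite marginals -/

/-- The operator `X ⊗ τ` on `(A₀ B₀) R₀`, for `X` on `A₀ R₀` and `τ` on `B₀`. -/
def feedB {a0 b0 r0 : Type*} (τ : Op b0) (X : Op (a0 × r0)) : Op ((a0 × b0) × r0) :=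
  Matrix.of fun s t => X (s.1.1, s.2) (t.1.1, t.2) * τ s.1.2 t.1.2

/-- The operator `σ ⊗ X` on `(A₀ B₀) R₀`, for `σ` on `A₀` and `X` on `B₀ R₀`. -/
def feedA {a0 b0 r0 : Type*} (σ : Op a0) (X : Op (b0 × r0)) : Op ((a0 × b0) × r0) :=
  Matrix.of fun s t => σ s.1.1 t.1.1 * X (s.1.2, s.2) (t.1.2, t.2)

/-- The marginal `Ω^{AR}` of a tripartite map `Ω^{ABR}`: the operator `τ` is fed into the input
`B₀` and the output `B₁` is traced out. -/
def marginalAR {a0 a1 b0 b1 r0 r1 : Type*} [Fintype b1] (τ : Op b0)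
    (Ω : LinMap ((a0 × b0) × r0) ((a1 × b1) × r1)) : LinMap (a0 × r0) (a1 × r1) where
  toFun X := Matrix.of fun p q => ∑ k, Ω (feedB τ X) ((p.1, k), p.2) ((q.1, k), q.2)
  map_add' X Y := by
    have h : feedB τ (X + Y) = feedB τ X + feedB τ Y := by
      ext; simp [feedB, add_mul]
    ext p q
    simp [h, Finset.sum_add_distrib]
  map_smul' c X := by
    have h : feedB τ (c • X) = c • feedB τ X := by
      ext; simp [feedB, mul_assoc]
    ext p q
    simp [h, Finset.mul_sum]

/-- The marginal `Ω^{BR}` of a tripartite map `Ω^{ABR}`: the operator `σ` is fed into the input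
`A₀` and the output `A₁` is traced out. -/
def marginalBR {a0 a1 b0 b1 r0 r1 : Type*} [Fintype a1] (σ : Op a0)
    (Ω : LinMap ((a0 × b0) × r0) ((a1 × b1) × r1)) : LinMap (b0 × r0) (b1 × r1) where
  toFun X := Matrix.of fun p q => ∑ k, Ω (feedA σ X) ((k, p.1), p.2) ((k, q.1), q.2)
  map_add' X Y := by
    have h : feedA σ (X + Y) = feedA σ X + feedA σ Y := by
      ext; simp [feedA, mul_add]
    ext p q
    simp [h, Finset.sum_add_distrib]
  map_smul' c X := by
    have h : feedA σ (c • X) = c • feedA σ X := by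
      ext; simp [feedA, mul_left_comm]
    ext p q
    simp [h, Finset.mul_sum]

/-- The tripartite map `Λ^{ABR} = (1/n) ∑ⱼ Ψⱼ ⊗ Φⱼ ⊗ Λⱼ`. -/
def mixABR {n : ℕ} {a0 a1 b0 b1 r0 r1 : Type*} [Fintype a0] [DecidableEq a0]
    [Fintype b0] [DecidableEq b0] (Ψ : Fin n → LinMap a0 a1) (Φ : Fin n → LinMap b0 b1)
    (Λ : Fin n → LinMap r0 r1) : LinMap ((a0 × b0) × r0) ((a1 × b1) × r1) :=
  (1 / (n : ℂ)) • ∑ j, tensorMap (tensorMap (Ψ j) (Φ j)) (Λ j)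

/-- The divergence `C_Λ(Ψ₁‖Ψ₂) = - H_min^ext(R|A)` of two channels, evaluated on the bipartite
channel `(Ψ₁ ⊗ Λ₁ + Ψ₂ ⊗ Λ₂) / 2`, for a pair `Λ = (Λ₁, Λ₂)` of channels of the system `R`. -/
def channelDiv {a0 a1 r0 r1 : Type*} [Fintype a0] [DecidableEq a0] [Fintype a1] [DecidableEq a1]
    [Fintype r0] [DecidableEq r0] [DecidableEq r1]
    (Λ₁ Λ₂ : LinMap r0 r1) (Ψ₁ Ψ₂ : LinMap a0 a1) : ℝ :=
  - hMinExt ((1 / 2 : ℂ) • (tensorMap Ψ₁ Λ₁ + tensorMap Ψ₂ Λ₂))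

end

/-! Feeding a state through a trace-preserving map and tracing out the output contributes the factor
1, so both marginals are mixtures `mixMap`, whatever the states. For such a mixture a feasible `γ`
is, up to the factor `n d_{A₀} d_{R₀}`, a block matrix `Γ` of maps on `A`, indexed by `R₀`, for
which `Γ ⊗ I - ∑ⱼ Λⱼ ⊗ Ψⱼ` has a positive semidefinite Choi matrix and the block `Γ ρ ρ'` multiplies
traces by `g ρ ρ'`. The objective becomes `Tr g / (n d_{R₀})` (`feasible_values_mixMap`).

Monotonicity: a superchannel applied to every block keeps positivity, being completely CP
preserving, and keeps `g`, being TP preserving (`Majorizes.map`). Every value attained for `Ψ` is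
then attained for its image, so the infimum can only drop.

The converse is conic duality. A positive semidefinite `J` meeting the linear equations
`combConstraints` is the Choi matrix of a superchannel taking `Ψⱼ` to `Φⱼ`. These equations fix the
trace of `J`, so compactness and Hahn-Banach yield a separating functional when there is no such
`J`. Its components assemble into Hermitian `Mⱼ` and a `Γ` majorizing `∑ⱼ Mⱼ ⊗ Ψⱼ` with `Tr g < ∑ⱼ
⟨Φⱼ, Mⱼ⟩` (`exists_dual_certificate`). Adding `Zⱼ ⊗ I` to `Mⱼ` shifts both sides by `Tr Zⱼ`; this
freedom and a rescaling turn the `Mⱼ` into Choi matrices of channels `Λⱼ`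
(`exists_channels_majorizes`). Since `R` is a copy of `B`, every majorant for `Φ` has `Tr g ≥ ∑ⱼ
⟨Φⱼ, Λⱼ⟩` (`Majorizes.pairing_le`), so these `Λⱼ` violate the entropy inequality. -/

noncomputable section

/-! ### Positive semidefinite matrices -/

section PosSemidef

open scoped MatrixOrder Matrix.Norms.L2Operator in
/-- A Hermitian matrix becomes positive semidefinite after adding a large multiple of `1`. -/
theorem Matrix.IsHermitian.exists_add_smul_one_posSemidef {d : Type*} [Fintype d] [DecidableEq d]
    {A : Matrix d d ℂ} (hA : A.IsHermitian) :
    ∃ c : ℝ, 0 ≤ c ∧ ∀ c' : ℝ, c ≤ c' → (A + (c' : ℂ) • (1 : Matrix d d ℂ)).PosSemidef := by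
  refine ⟨‖A‖, norm_nonneg _, fun c' hc' => ?_⟩
  have h := IsSelfAdjoint.neg_algebraMap_norm_le_self (a := A) (ha := hA)
  have h1 : (A + ((‖A‖ : ℝ) : ℂ) • (1 : Matrix d d ℂ)).PosSemidef := by
    have h' := Matrix.le_iff.1 h
    rw [sub_neg_eq_add, Algebra.algebraMap_eq_smul_one] at h'
    rw [show ((‖A‖ : ℝ) : ℂ) • (1 : Matrix d d ℂ) = ‖A‖ • 1 by ext; simp]
    exact h'
  have h2 : (((c' - ‖A‖ : ℝ) : ℂ) • (1 : Matrix d d ℂ)).PosSemidef :=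
    Matrix.PosSemidef.one.smul (by exact_mod_cast sub_nonneg.2 hc')
  convert h1.add h2 using 1
  rw [add_assoc, ← add_smul]
  simp

/-- The bilinear pairing `Tr (X Yᵀ)` of two matrices. -/
def pairing {d : Type*} [Fintype d] (X Y : Op d) : ℂ := ∑ p, ∑ q, X p q * Y p q

/-- Summing a positive semidefinite matrix over the blocks of the second factor. -/
theorem Matrix.PosSemidef.sum_blocks {p x : Type*} [Fintype p] [Fintype x] [DecidableEq p]
    {M : Op (p × x)} (hM : M.PosSemidef) :
    (Matrix.of fun s t : p => ∑ i, ∑ j, M (s, i) (t, j)).PosSemidef := by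
  have h := hM.conjTranspose_mul_mul_same
    (Matrix.of fun (s : p × x) (t : p) => if s.1 = t then (1 : ℂ) else 0)
  convert h using 1
  ext s t
  rw [Matrix.of_apply, Finset.sum_comm]
  simp only [Matrix.mul_apply, Matrix.conjTranspose_apply, Matrix.of_apply,
    Fintype.sum_prod_type]
  simp [apply_ite, ite_mul, Finset.sum_ite_irrel]

/-- The link product of two positive semidefinite matrices is positive semidefinite. -/
theorem posSemidef_link {p x k : Type*} [Fintype p] [Fintype x] [Fintype k] [DecidableEq p]
    [DecidableEq x] [DecidableEq k]
    {X : Op (p × x)} {Y : Op (x × k)} (hX : X.PosSemidef) (hY : Y.PosSemidef) :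
    (Matrix.of fun s t : p × k =>
      ∑ i, ∑ j, X (s.1, i) (t.1, j) * Y (i, s.2) (j, t.2)).PosSemidef :=
  ((hX.kronecker hY).submatrix
    fun s : (p × k) × x => ((s.1.1, s.2), (s.2, s.1.2))).sum_blocks

theorem pairing_vecMulVec {d : Type*} [Fintype d] (v : d → ℂ) (Z : Op d) :
    pairing (Matrix.vecMulVec (star v) v) Z = star v ⬝ᵥ Z.mulVec v := by
  simp only [pairing, Matrix.vecMulVec_apply, dotProduct, Matrix.mulVec, Finset.mul_sum]
  refine Finset.sum_congr rfl fun i _ => Finset.sum_congr rfl fun j _ => ?_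
  ring

theorem Matrix.IsHermitian.posSemidef_of_pairing {d : Type*} [Fintype d] {Z : Op d}
    (hZ : Z.IsHermitian) (h : ∀ X : Op d, X.PosSemidef → 0 ≤ (pairing X Z).re) :
    Z.PosSemidef := by
  refine .of_dotProduct_mulVec_nonneg hZ fun x => ?_
  have h1 := h _ (Matrix.posSemidef_vecMulVec_star_self x)
  rw [pairing_vecMulVec] at h1
  exact Complex.nonneg_iff.2 ⟨h1, (hZ.im_star_dotProduct_mulVec_self x).symm⟩

end PosSemidef

/-! ### Choi matrices -/

section Choi

theorem choi_apply {a0 a1 : Type*} [Fintype a0] [DecidableEq a0] (Ψ : LinMap a0 a1)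
    (i j : a0) (k l : a1) : choi Ψ (i, k) (j, l) = Ψ (Matrix.single i j 1) k l := by
  simp only [choi, Matrix.sum_apply, Matrix.kronecker_apply, Matrix.single_apply]
  rw [Finset.sum_eq_single i, Finset.sum_eq_single j] <;> simp +contextual

theorem choi_apply' {a0 a1 : Type*} [Fintype a0] [DecidableEq a0] (Ψ : LinMap a0 a1)
    (x y : a0 × a1) : choi Ψ x y = Ψ (Matrix.single x.1 y.1 1) x.2 y.2 :=
  choi_apply Ψ _ _ _ _

/-- The linear map with a given Choi matrix. -/
def ofChoi {a0 a1 : Type*} [Fintype a0] (M : Op (a0 × a1)) : LinMap a0 a1 where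
  toFun X := Matrix.of fun k l => ∑ i, ∑ j, X i j * M (i, k) (j, l)
  map_add' X Y := by
    ext; simp [add_mul, Finset.sum_add_distrib]
  map_smul' c X := by
    ext; simp [mul_assoc, Finset.mul_sum]

variable {a0 a1 b0 b1 : Type*} [Fintype a0] [DecidableEq a0] 

theorem linMap_apply_eq (Ψ : LinMap a0 a1) (X : Op a0) (k l : a1) :
    Ψ X k l = ∑ i, ∑ j, X i j * choi Ψ (i, k) (j, l) := by
  conv_lhs => rw [Matrix.matrix_eq_sum_single X]
  simp only [map_sum, Matrix.sum_apply, choi_apply]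
  refine Finset.sum_congr rfl fun i _ => Finset.sum_congr rfl fun j _ => ?_
  rw [← mul_one (X i j), ← smul_eq_mul (X i j), ← Matrix.smul_single, map_smul]
  simp

theorem choi_injective {Ψ Φ : LinMap a0 a1} (h : choi Ψ = choi Φ) : Ψ = Φ := by
  ext1 X
  ext k l
  rw [linMap_apply_eq, linMap_apply_eq, h]

@[simp] theorem choi_ofChoi (M : Op (a0 × a1)) : choi (ofChoi M) = M := by
  ext ⟨i, k⟩ ⟨j, l⟩
  rw [choi_apply]
  simp only [ofChoi, LinearMap.coe_mk, AddHom.coe_mk, Matrix.of_apply, Matrix.single_apply]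
  simp [ite_and]

theorem choi_add (Ψ Φ : LinMap a0 a1) : choi (Ψ + Φ) = choi Ψ + choi Φ := by
  ext ⟨i, k⟩ ⟨j, l⟩; simp [choi_apply]

theorem choi_sub (Ψ Φ : LinMap a0 a1) : choi (Ψ - Φ) = choi Ψ - choi Φ := by
  ext ⟨i, k⟩ ⟨j, l⟩; simp [choi_apply]

theorem choi_smul (c : ℂ) (Ψ : LinMap a0 a1) : choi (c • Ψ) = c • choi Ψ := by
  ext ⟨i, k⟩ ⟨j, l⟩; simp [choi_apply]

theorem choi_zero : choi (0 : LinMap a0 a1) = 0 := by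
  ext ⟨i, k⟩ ⟨j, l⟩; simp [choi_apply]

theorem choi_sum {ι : Type*} (s : Finset ι) (Ψ : ι → LinMap a0 a1) :
    choi (∑ j ∈ s, Ψ j) = ∑ j ∈ s, choi (Ψ j) := by
  ext ⟨i, k⟩ ⟨j, l⟩; simp [choi_apply, Matrix.sum_apply]

theorem block_single {p q : Type*} [DecidableEq p] [DecidableEq q] (i j : p) (k l : q) (i' j' : p) :
    block (Matrix.single (i, k) (j, l) (1 : ℂ)) i' j' =
      if i = i' ∧ j = j' then Matrix.single k l 1 else 0 := by
  ext r s
  simp only [block, Matrix.of_apply, Matrix.single_apply, Prod.mk.injEq]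
  split_ifs <;> simp_all

theorem choi_tensorMap [Fintype b0] [DecidableEq b0] (Ψ : LinMap a0 a1) (Φ : LinMap b0 b1)
    (i j : a0) (i' j' : b0) (k l : a1) (k' l' : b1) :
    choi (tensorMap Ψ Φ) ((i, i'), (k, k')) ((j, j'), (l, l')) =
      choi Ψ (i, k) (j, l) * choi Φ (i', k') (j', l') := by
  simp only [choi_apply]
  simp only [tensorMap, LinearMap.coe_mk, AddHom.coe_mk, block_single, Matrix.sum_apply,
    Matrix.kronecker_apply]
  rw [Finset.sum_eq_single i, Finset.sum_eq_single j] <;> simp +contextual [eq_comm]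

variable [Fintype a1]

/-- **Choi's theorem**. -/
theorem isCP_iff_posSemidef_choi [DecidableEq a1] {Ψ : LinMap a0 a1} : IsCP Ψ ↔ (choi Ψ).PosSemidef := by
  constructor
  · intro h
    let e := Fintype.equivFin a0
    -- The test operator is the unnormalized maximally entangled state, with one copy of `a0`
    -- relabelled by `Fin`.
    have h1 := h (Fintype.card a0) _ (Matrix.posSemidef_vecMulVec_self_star
      (fun s : Fin (Fintype.card a0) × a0 => if e s.2 = s.1 then (1 : ℂ) else 0))
    convert h1.submatrix (fun s : a0 × a1 => (e s.1, s.2)) using 1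
    ext ⟨i, k⟩ ⟨j, l⟩
    rw [choi_apply]
    simp only [Matrix.submatrix_apply, Matrix.of_apply]

    refine congrArg (fun Y => Ψ Y k l) ?_
    ext i' j'
    simp [block, Matrix.vecMulVec_apply, Matrix.single_apply, ← ite_and, eq_comm, and_comm]
  · intro h k X hX
    convert posSemidef_link hX h using 1
    ext s t
    simp [linMap_apply_eq Ψ, block]

/-- A linear map multiplies traces by `c` iff the partial trace of its Choi matrix is `c • 1`. -/
theorem trace_apply_iff {Ψ : LinMap a0 a1} {c : ℂ} :
    (∀ X, (Ψ X).trace = c * X.trace) ↔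
      ∀ i j, ∑ k, choi Ψ (i, k) (j, k) = if i = j then c else 0 := by
  constructor
  · intro h i j
    have := h (Matrix.single i j 1)
    simp only [Matrix.trace, Matrix.diag_apply, choi_apply] at this ⊢
    rw [this]
    simp [Matrix.single_apply, ite_and, eq_comm]
  · intro h X
    simp only [Matrix.trace, Matrix.diag_apply, linMap_apply_eq Ψ]
    rw [Finset.sum_comm]
    simp_rw [Finset.sum_comm (s := Finset.univ (α := a1)), ← Finset.mul_sum, h]
    simp [Finset.mul_sum, mul_comm]

theorem isTP_iff {Ψ : LinMap a0 a1} :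
    IsTP Ψ ↔ ∀ i j, ∑ k, choi Ψ (i, k) (j, k) = if i = j then 1 else 0 := by
  rw [← trace_apply_iff]
  simp [IsTP]

end Choi

/-! ### Complete CP preservation in terms of Choi matrices -/

section Superchannel

/-- The Choi matrix of a block matrix of linear maps. -/
def blockChoi {s a0 a1 : Type*} [Fintype a0] [DecidableEq a0] (F : s → s → LinMap a0 a1) :
    Op (s × (a0 × a1)) :=
  Matrix.of fun p q => choi (F p.1 q.1) p.2 q.2

variable {a0 a1 b0 b1 : Type*} [Fintype a0] [DecidableEq a0] [Fintype b0] [DecidableEq b0]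

theorem choi_component {c0 c1 : Type*} [Fintype c0] [DecidableEq c0]
    (Ω : LinMap (c0 × a0) (c1 × a1)) (i j : c0) (k l : c1) (x y : a0 × a1) :
    choi (component Ω i j k l) x y = choi Ω ((i, x.1), (k, x.2)) ((j, y.1), (l, y.2)) := by
  rw [choi_apply', choi_apply]
  simp only [component, LinearMap.coe_mk, AddHom.coe_mk, block, Matrix.of_apply]
  rw [Matrix.single_kronecker_single, mul_one]

omit [Fintype a0] [DecidableEq a0] in
-- On Choi matrices `𝟙 ⊗ Θ` acts block by block over the indices of `C`. This ties the definition of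
-- complete CP preservation to block matrices of maps.
theorem choi_idTensorSuper {c0 c1 : Type*} [Fintype c0] [DecidableEq c0] [Fintype c1]
    [DecidableEq c1] (Θ : SuperMap a0 a1 b0 b1) (Ω : LinMap (c0 × a0) (c1 × a1))
    (i j : c0) (k l : c1) (x y : b0 × b1) :
    choi (idTensorSuper Θ Ω) ((i, x.1), (k, x.2)) ((j, y.1), (l, y.2)) =
      choi (Θ (component Ω i j k l)) x y := by
  have hb (i' j' : c0) (k' l' : c1) : choi (basisMap i' j' k' l') (i, k) (j, l) =
      if i' = i then if j' = j then if k' = k then if l' = l then (1 : ℂ) else 0 else 0 else 0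
      else 0 := by
    simp only [choi_apply, basisMap, LinearMap.coe_mk, AddHom.coe_mk, Matrix.smul_apply,
      Matrix.single_apply, smul_eq_mul, mul_ite, mul_one, mul_zero, ← ite_and, eq_comm]
    exact if_congr (by tauto) rfl rfl
  simp only [idTensorSuper, choi_sum, Matrix.sum_apply, choi_tensorMap, hb]
  simp

/-- A completely CP preserving supermap preserves positivity of block matrices of maps. -/
theorem IsCompletelyCPP.posSemidef_blockChoi [Fintype a1] [DecidableEq a1]
    [Fintype b1] [DecidableEq b1] {Θ : SuperMap a0 a1 b0 b1} (hΘ : IsCompletelyCPP Θ)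
    {s : Type*} [Fintype s] (F : s → s → LinMap a0 a1) (hF : (blockChoi F).PosSemidef) :
    (blockChoi fun p q => Θ (F p q)).PosSemidef := by
  let e := Fintype.equivFin s
  -- The block index becomes `C₀`, and `C₁` is trivial; positivity of the block matrix then says
  -- that `Ω` is CP.
  let Ω : LinMap (Fin (Fintype.card s) × a0) (Fin 1 × a1) :=
    ofChoi (Matrix.of fun x y =>
      choi (F (e.symm x.1.1) (e.symm y.1.1)) (x.1.2, x.2.2) (y.1.2, y.2.2))
  have hΩ : IsCP Ω := by
    rw [isCP_iff_posSemidef_choi, choi_ofChoi]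
    exact hF.submatrix fun x : (Fin (Fintype.card s) × a0) × (Fin 1 × a1) =>
      (e.symm x.1.1, (x.1.2, x.2.2))
  have hc (p q : s) : component Ω (e p) (e q) 0 0 = F p q := by
    refine choi_injective ?_
    ext x y
    rw [choi_component, choi_ofChoi]
    simp
  have h := isCP_iff_posSemidef_choi.1 (hΘ _ _ Ω hΩ)
  convert h.submatrix fun x : s × (b0 × b1) => ((e x.1, x.2.1), ((0 : Fin 1), x.2.2)) using 1
  ext x y
  rw [Matrix.submatrix_apply, choi_idTensorSuper, hc]
  rfl

/-- The supermap with Choi matrix `J`. -/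
def superOfChoi [Fintype a1] (J : Op ((b0 × b1) × (a0 × a1))) : SuperMap a0 a1 b0 b1 where
  toFun Ψ := ofChoi (Matrix.of fun y y' => ∑ x, ∑ x', J (y, x) (y', x') * choi Ψ x x')
  map_add' Ψ Φ := by
    refine choi_injective ?_
    ext y y'
    simp [choi_add, mul_add, Finset.sum_add_distrib]
  map_smul' c Ψ := by
    refine choi_injective ?_
    ext y y'
    simp [choi_smul, mul_left_comm, Finset.mul_sum]

theorem choi_superOfChoi [Fintype a1] (J : Op ((b0 × b1) × (a0 × a1))) (Ψ : LinMap a0 a1)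
    (y y' : b0 × b1) :
    choi (superOfChoi J Ψ) y y' = ∑ x, ∑ x', J (y, x) (y', x') * choi Ψ x x' := by
  simp [superOfChoi]

/-- The Choi matrix of `𝟙 ⊗ Θ` applied to `Ω` is the link product of `J` with the Choi matrix of
`Ω`, up to reordering factors. -/
theorem isCompletelyCPP_superOfChoi [Fintype a1] [DecidableEq a1] [Fintype b1] [DecidableEq b1]
    {J : Op ((b0 × b1) × (a0 × a1))} (hJ : J.PosSemidef) :
    IsCompletelyCPP (superOfChoi J) := by
  intro m n Ω hΩ
  rw [isCP_iff_posSemidef_choi] at hΩ ⊢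
  have h := posSemidef_link hJ (hΩ.submatrix fun x : (a0 × a1) × (Fin m × Fin n) =>
    ((x.2.1, x.1.1), (x.2.2, x.1.2)))
  convert h.submatrix fun x : (Fin m × b0) × (Fin n × b1) =>
    ((x.1.2, x.2.2), (x.1.1, x.2.1)) using 1
  ext ⟨⟨i, β⟩, ⟨k, δ⟩⟩ ⟨⟨j, β'⟩, ⟨l, δ'⟩⟩
  rw [choi_idTensorSuper _ Ω i j k l (β, δ) (β', δ'), choi_superOfChoi]
  simp [choi_component]

/-- A supermap whose Choi matrix satisfies `Tr_{B₁} J = J' ⊗ I^{A₁}` with `Tr_{A₀} J' = I^{B₀}`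
is TP preserving. -/
theorem isTPP_superOfChoi [Fintype a1] [DecidableEq a1] [Fintype b1]
    {J : Op ((b0 × b1) × (a0 × a1))} (K : Op (b0 × a0))
    (hJ : ∀ β β' α α' κ κ', ∑ δ, J ((β, δ), (α, κ)) ((β', δ), (α', κ')) =
      if κ = κ' then K (β, α) (β', α') else 0)
    (hK : ∀ β β', ∑ α, K (β, α) (β', α) = if β = β' then 1 else 0) :
    IsTPP (superOfChoi J) := by
  intro Ψ hΨ
  rw [isTP_iff] at hΨ ⊢
  intro β β'
  simp only [choi_superOfChoi]
  rw [Finset.sum_comm]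
  simp_rw [Finset.sum_comm (s := Finset.univ (α := b1)), ← Finset.sum_mul,
    Fintype.sum_prod_type, hJ, ite_mul, zero_mul]
  simp only [Finset.sum_ite_eq, Finset.mem_univ, if_true]
  rw [← hK]
  refine Finset.sum_congr rfl fun α _ => ?_
  rw [Finset.sum_comm]
  simp_rw [← Finset.mul_sum, hΨ]
  simp

omit [DecidableEq a0] [DecidableEq b0] in
/-- A TP preserving supermap scales traces like its argument. -/
theorem IsTPP.trace_apply [Fintype a1] [Nonempty a1] [Fintype b1] {Θ : SuperMap a0 a1 b0 b1}
    (hΘ : IsTPP Θ) {Ψ : LinMap a0 a1} {c : ℂ} (h : ∀ X, (Ψ X).trace = c * X.trace) (X : Op b0) :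
    (Θ Ψ X).trace = c * X.trace := by
  classical
  obtain ⟨k⟩ := ‹Nonempty a1›
  -- `Φ` sends `X` to `Tr X |k⟩⟨k|`. Adding `(1 - c) • Φ` makes `Ψ` trace preserving, and linearity
  -- of `Θ` removes the correction.
  let Φ : LinMap a0 a1 :=
    { toFun := fun X => Matrix.single k k X.trace
      map_add' := fun X Y => by simp [Matrix.single_add]
      map_smul' := fun c X => by simp [Matrix.smul_single] }
  have hΦ : IsTP Φ := fun X => by simp [Φ]
  have h1 : IsTP (Ψ + (1 - c) • Φ) := fun X => by
    simp [Matrix.trace_add, Matrix.trace_smul, h, hΦ X]; ring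
  have h2 := hΘ _ h1 X
  have h3 := hΘ _ hΦ X
  rw [map_add, map_smul, LinearMap.add_apply, LinearMap.smul_apply, Matrix.trace_add,
    Matrix.trace_smul, h3, smul_eq_mul] at h2
  linear_combination h2

end Superchannel

/-! ### The min-entropy of a mixture of product maps -/

section Majorant

variable {n : ℕ} {a0 a1 b0 b1 r0 r1 : Type*} [Fintype a0] [DecidableEq a0]
  [Fintype r0] [DecidableEq r0]

/-- The uniform mixture `(1/n) ∑ⱼ Ψⱼ ⊗ Λⱼ`. -/
def mixMap (Ψ : Fin n → LinMap a0 a1) (Λ : Fin n → LinMap r0 r1) :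
    LinMap (a0 × r0) (a1 × r1) :=
  (1 / (n : ℂ)) • ∑ j, tensorMap (Ψ j) (Λ j)

/-- The block matrix of maps `Γ ⊗ I - ∑ⱼ Λⱼ ⊗ Ψⱼ`. -/
def gapBlock [DecidableEq r1] (Ψ : Fin n → LinMap a0 a1) (M : Fin n → Op (r0 × r1))
    (Γ : r0 → r0 → LinMap a0 a1) (p q : r0 × r1) : LinMap a0 a1 :=
  (if p.2 = q.2 then Γ p.1 q.1 else 0) - ∑ j, M j p q • Ψ j

omit [Fintype r0] [DecidableEq r0] in
theorem blockChoi_gapBlock_apply [DecidableEq r1] (Ψ : Fin n → LinMap a0 a1)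
    (M : Fin n → Op (r0 × r1)) (Γ : r0 → r0 → LinMap a0 a1) (p q : r0 × r1) (x y : a0 × a1) :
    blockChoi (gapBlock Ψ M Γ) (p, x) (q, y) =
      (if p.2 = q.2 then choi (Γ p.1 q.1) x y else 0) - ∑ j, M j p q * choi (Ψ j) x y := by
  simp only [blockChoi, gapBlock, Matrix.of_apply, choi_sub, choi_sum, choi_smul,
    Matrix.sub_apply, Matrix.sum_apply, Matrix.smul_apply, smul_eq_mul]
  split_ifs <;> simp [choi_zero]

/-- A rescaled form of the constraints defining the extended conditional min-entropy of
`∑ⱼ Ψⱼ ⊗ Λⱼ`, in which `Γ` is a block matrix of maps which multiply the trace by the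
entries of `g`. -/
def Majorizes [Fintype a1] [DecidableEq r1] (Ψ : Fin n → LinMap a0 a1)
    (Λ : Fin n → LinMap r0 r1) (Γ : r0 → r0 → LinMap a0 a1) (g : Op r0) : Prop :=
  (blockChoi (gapBlock Ψ (fun j => choi (Λ j)) Γ)).PosSemidef ∧
    ∀ ρ ρ' X, (Γ ρ ρ' X).trace = g ρ ρ' * X.trace

/-- Being linear, `Θ` commutes with forming the gap block, and `g` does not change, so the objective
value is preserved exactly. -/
theorem Majorizes.map [Fintype a1] [DecidableEq a1] [Nonempty a1] [DecidableEq r1] [Fintype r1]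
    [Fintype b0] [DecidableEq b0] [Fintype b1] [DecidableEq b1]
    {Ψ : Fin n → LinMap a0 a1} {Λ : Fin n → LinMap r0 r1} {Γ : r0 → r0 → LinMap a0 a1}
    {g : Op r0} (h : Majorizes Ψ Λ Γ g) {Θ : SuperMap a0 a1 b0 b1} (hΘ : IsSuperchannel Θ) :
    Majorizes (fun j => Θ (Ψ j)) Λ (fun ρ ρ' => Θ (Γ ρ ρ')) g := by
  refine ⟨?_, fun ρ ρ' => hΘ.2.trace_apply (h.2 ρ ρ')⟩
  have e : (fun p q => Θ (gapBlock Ψ (fun j => choi (Λ j)) Γ p q)) =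
      gapBlock (fun j => Θ (Ψ j)) (fun j => choi (Λ j)) (fun ρ ρ' => Θ (Γ ρ ρ')) := by
    funext p q
    simp only [gapBlock, map_sub, map_sum, map_smul, apply_ite Θ, map_zero]
  exact e ▸ hΘ.1.posSemidef_blockChoi _ h.1

theorem normChoi_mixMap_apply (Ψ : Fin n → LinMap a0 a1) (Λ : Fin n → LinMap r0 r1)
    (x y : (a0 × r0) × (a1 × r1)) :
    normChoi (mixMap Ψ Λ) x y = 1 / ((n : ℂ) * Fintype.card a0 * Fintype.card r0) *
      ∑ j, choi (Ψ j) (x.1.1, x.2.1) (y.1.1, y.2.1) *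
        choi (Λ j) (x.1.2, x.2.2) (y.1.2, y.2.2) := by
  obtain ⟨⟨α, ρ⟩, κ, r⟩ := x
  obtain ⟨⟨α', ρ'⟩, κ', r'⟩ := y
  simp only [normChoi, mixMap, choi_smul, choi_sum, Matrix.smul_apply, Matrix.sum_apply,
    choi_tensorMap, smul_eq_mul]
  rw [← mul_assoc, one_div_mul_one_div]
  congr 2
  ring

variable [Fintype a1] [DecidableEq r1] [Nonempty a0] [Nonempty r0]

omit [Fintype a1] in
theorem blockChoi_gapBlock_eq (hn : 0 < n) {Ψ : Fin n → LinMap a0 a1} {Λ : Fin n → LinMap r0 r1}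
    {γ : Op ((a0 × r0) × a1)} {Γ : r0 → r0 → LinMap a0 a1}
    (hΓ : ∀ ρ ρ' x y, choi (Γ ρ ρ') x y = ((n : ℂ) * Fintype.card a0 * Fintype.card r0) *
      γ ((x.1, ρ), x.2) ((y.1, ρ'), y.2)) :
    blockChoi (gapBlock Ψ (fun j => choi (Λ j)) Γ) =
      ((n : ℂ) * Fintype.card a0 * Fintype.card r0) •
      (Matrix.reindex (Equiv.prodAssoc (a0 × r0) a1 r1) (Equiv.prodAssoc (a0 × r0) a1 r1)
        (γ ⊗ₖ (1 : Op r1)) - normChoi (mixMap Ψ Λ)).submatrix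
        (fun x : (r0 × r1) × (a0 × a1) => ((x.2.1, x.1.1), (x.2.2, x.1.2)))
        (fun x : (r0 × r1) × (a0 × a1) => ((x.2.1, x.1.1), (x.2.2, x.1.2))) := by
  have hn' : (n : ℂ) ≠ 0 := by exact_mod_cast hn.ne'
  have ha : (Fintype.card a0 : ℂ) ≠ 0 := by exact_mod_cast Fintype.card_ne_zero
  have hr : (Fintype.card r0 : ℂ) ≠ 0 := by exact_mod_cast Fintype.card_ne_zero
  ext ⟨⟨ρ, r⟩, α, κ⟩ ⟨⟨ρ', r'⟩, α', κ'⟩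
  rw [blockChoi_gapBlock_apply]
  simp only [Matrix.sub_apply, Matrix.smul_apply, smul_eq_mul, Matrix.submatrix_apply,
    Matrix.reindex_apply, Matrix.kronecker_apply, normChoi_mixMap_apply, mul_sub,
    Equiv.prodAssoc_symm_apply, Matrix.one_apply]
  have hc (z : ℂ) : (n : ℂ) * Fintype.card a0 * Fintype.card r0 *
      (1 / ((n : ℂ) * Fintype.card a0 * Fintype.card r0) * z) = z := by field_simp
  rw [hc]
  congr 1
  · split_ifs <;> simp [hΓ]
  · exact Finset.sum_congr rfl fun j _ => mul_comm _ _

/-- The operator inequality is the positivity of the gap block after a permutation of tensor factors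
and a positive rescaling. The constraint `γ^{A₀R₀} = u ⊗ γ^{R₀}` says that the partial trace over
`A₁` of each `R₀` block is a multiple of the identity, which is how a map rescaling all traces looks
on the Choi side. -/
theorem isFeasible_iff_majorizes (hn : 0 < n) {Ψ : Fin n → LinMap a0 a1}
    {Λ : Fin n → LinMap r0 r1} {γ : Op ((a0 × r0) × a1)} {Γ : r0 → r0 → LinMap a0 a1}
    (hΓ : ∀ ρ ρ' x y, choi (Γ ρ ρ') x y = ((n : ℂ) * Fintype.card a0 * Fintype.card r0) *
      γ ((x.1, ρ), x.2) ((y.1, ρ'), y.2)) :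
    IsFeasible (mixMap Ψ Λ) γ ↔ ∃ g, Majorizes Ψ Λ Γ g := by
  have hn' : (n : ℂ) ≠ 0 := by exact_mod_cast hn.ne'
  have ha : (Fintype.card a0 : ℂ) ≠ 0 := by exact_mod_cast Fintype.card_ne_zero
  have hr : (Fintype.card r0 : ℂ) ≠ 0 := by exact_mod_cast Fintype.card_ne_zero
  have hN : ((n : ℂ) * Fintype.card a0 * Fintype.card r0) ≠ 0 :=
    mul_ne_zero (mul_ne_zero hn' ha) hr
  have hN0 : 0 ≤ ((n : ℂ) * Fintype.card a0 * Fintype.card r0) := by positivity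
  have hb := blockChoi_gapBlock_eq hn (Ψ := Ψ) (Λ := Λ) hΓ
  simp only [Majorizes, exists_and_left, IsFeasible]
  refine and_congr ⟨fun h => ?_, fun h => ?_⟩ ⟨fun h => ?_, fun ⟨g, hg⟩ => ?_⟩
  · rw [hb]
    exact (h.submatrix _).smul hN0
  · rw [hb] at h
    have h' := (h.smul (inv_nonneg.2 hN0)).submatrix
      (fun x : (a0 × r0) × (a1 × r1) => ((x.1.2, x.2.2), (x.1.1, x.2.1)))
    rw [inv_smul_smul₀ hN] at h'
    exact h'
  · refine ⟨((n : ℂ) * Fintype.card r0) • ptraceLeft (ptraceRight γ), fun ρ ρ' => ?_⟩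
    rw [trace_apply_iff]
    intro α α'
    have h' := congrFun (congrFun h (α, ρ)) (α', ρ')
    simp only [ptraceRight, Matrix.of_apply, maxMixed, Matrix.kronecker_apply, Matrix.smul_apply,
      Matrix.one_apply, smul_eq_mul] at h' ⊢
    simp only [hΓ, ← Finset.mul_sum, h']
    split_ifs <;> [field_simp; simp]
  · ext ⟨α, ρ⟩ ⟨α', ρ'⟩
    have h' (α α' : a0) : ∑ κ, γ ((α, ρ), κ) ((α', ρ'), κ) =
        ((n : ℂ) * Fintype.card a0 * Fintype.card r0)⁻¹ * if α = α' then g ρ ρ' else 0 := by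
      rw [← trace_apply_iff.1 (hg ρ ρ') α α']
      simp only [hΓ, ← Finset.mul_sum, inv_mul_cancel_left₀ hN]
    simp only [ptraceRight, ptraceLeft, Matrix.of_apply, maxMixed, Matrix.kronecker_apply,
      Matrix.smul_apply, Matrix.one_apply, smul_eq_mul, h']
    split_ifs <;> simp

theorem Majorizes.trace_eq (hn : 0 < n) {Ψ : Fin n → LinMap a0 a1}
    {Λ : Fin n → LinMap r0 r1} {γ : Op ((a0 × r0) × a1)} {Γ : r0 → r0 → LinMap a0 a1}
    (hΓ : ∀ ρ ρ' x y, choi (Γ ρ ρ') x y = ((n : ℂ) * Fintype.card a0 * Fintype.card r0) *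
      γ ((x.1, ρ), x.2) ((y.1, ρ'), y.2)) {g : Op r0} (h : Majorizes Ψ Λ Γ g) :
    γ.trace.re = g.trace.re / (n * Fintype.card r0) := by
  have hn' : (n : ℂ) ≠ 0 := by exact_mod_cast hn.ne'
  have ha : (Fintype.card a0 : ℂ) ≠ 0 := by exact_mod_cast Fintype.card_ne_zero
  have hr : (Fintype.card r0 : ℂ) ≠ 0 := by exact_mod_cast Fintype.card_ne_zero
  have h1 : ((n : ℂ) * Fintype.card a0 * Fintype.card r0) * γ.trace =
      Fintype.card a0 * g.trace := by
    simp only [Matrix.trace, Matrix.diag_apply, Fintype.sum_prod_type, Finset.mul_sum]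
    simp only [← hΓ _ _ (_, _) (_, _), trace_apply_iff.1 (h.2 _ _), if_true]
    simp [Finset.mul_sum]
  have h2 : γ.trace = g.trace / ((n * Fintype.card r0 : ℝ) : ℂ) := by
    push_cast
    field_simp
    apply mul_left_cancel₀ ha
    rw [← h1]
    ring
  rw [h2, Complex.div_ofReal_re]

/-- The values attained in the definition of the extended conditional min-entropy of a uniform
mixture of product maps. -/
theorem feasible_values_mixMap (hn : 0 < n) (Ψ : Fin n → LinMap a0 a1)
    (Λ : Fin n → LinMap r0 r1) :
    {t : ℝ | ∃ γ : Op ((a0 × r0) × a1), IsFeasible (mixMap Ψ Λ) γ ∧ t = γ.trace.re} =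
      {t : ℝ | ∃ Γ g, Majorizes Ψ Λ Γ g ∧ t = g.trace.re / (n * Fintype.card r0)} := by
  have hn' : (n : ℂ) ≠ 0 := by exact_mod_cast hn.ne'
  have ha : (Fintype.card a0 : ℂ) ≠ 0 := by exact_mod_cast Fintype.card_ne_zero
  have hr : (Fintype.card r0 : ℂ) ≠ 0 := by exact_mod_cast Fintype.card_ne_zero
  ext t
  constructor
  · rintro ⟨γ, hγ, rfl⟩
    let Γ : r0 → r0 → LinMap a0 a1 := fun ρ ρ' => ofChoi (Matrix.of fun x y =>
      ((n : ℂ) * Fintype.card a0 * Fintype.card r0) * γ ((x.1, ρ), x.2) ((y.1, ρ'), y.2))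
    have hΓ ρ ρ' x y : choi (Γ ρ ρ') x y = ((n : ℂ) * Fintype.card a0 * Fintype.card r0) *
      γ ((x.1, ρ), x.2) ((y.1, ρ'), y.2) := by simp [Γ]
    obtain ⟨g, hg⟩ := (isFeasible_iff_majorizes hn hΓ).1 hγ
    exact ⟨Γ, g, hg, hg.trace_eq hn hΓ⟩
  · rintro ⟨Γ, g, hg, rfl⟩
    let γ : Op ((a0 × r0) × a1) := Matrix.of fun x y =>
      ((n : ℂ) * Fintype.card a0 * Fintype.card r0)⁻¹ *
        choi (Γ x.1.2 y.1.2) (x.1.1, x.2) (y.1.1, y.2)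
    have hΓ ρ ρ' x y : choi (Γ ρ ρ') x y = ((n : ℂ) * Fintype.card a0 * Fintype.card r0) *
        γ ((x.1, ρ), x.2) ((y.1, ρ'), y.2) := by
      simp only [γ, Matrix.of_apply]
      rw [mul_inv_cancel_left₀ (mul_ne_zero (mul_ne_zero hn' ha) hr)]
    exact ⟨γ, (isFeasible_iff_majorizes hn hΓ).2 ⟨g, hg⟩, (hg.trace_eq hn hΓ).symm⟩

end Majorant

/-! ### Bounds on the majorant values and monotonicity of the min-entropy -/

section MinEntropy

variable {n : ℕ} {a0 a1 b0 b1 r0 r1 : Type*} [Fintype a0] [DecidableEq a0] [Fintype a1]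
  [DecidableEq a1] [Fintype b0] [DecidableEq b0] [Fintype b1] [DecidableEq b1]
  [Fintype r0] [DecidableEq r0] [Fintype r1] [DecidableEq r1]

/-- The values `Tr g / (n d_{R₀})` of the majorants of `∑ⱼ Ψⱼ ⊗ Λⱼ`. -/
def majorantValues (Ψ : Fin n → LinMap a0 a1) (Λ : Fin n → LinMap r0 r1) : Set ℝ :=
  {t : ℝ | ∃ Γ g, Majorizes Ψ Λ Γ g ∧ t = g.trace.re / (n * Fintype.card r0)}

omit [Fintype r1] in
theorem hMinExt_mixMap [Nonempty a0] [Nonempty r0] (hn : 0 < n) (Ψ : Fin n → LinMap a0 a1)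
    (Λ : Fin n → LinMap r0 r1) :
    hMinExt (mixMap Ψ Λ) = - Real.logb 2 (sInf (majorantValues Ψ Λ)) := by
  rw [hMinExt, feasible_values_mixMap hn]
  rfl

omit [DecidableEq a1] in
theorem IsTP.trace_choi {Ψ : LinMap a0 a1} (h : IsTP Ψ) :
    ∑ i, ∑ k, choi Ψ (i, k) (i, k) = Fintype.card a0 := by
  simp [isTP_iff.1 h]

omit [DecidableEq a1] in
-- The gap block has nonnegative trace, and this trace equals `d_{A₀} (d_{R₁} Tr g - n d_{R₀})`.
theorem Majorizes.le_trace [Nonempty a0] [Nonempty r1] {Ψ : Fin n → LinMap a0 a1}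
    {Λ : Fin n → LinMap r0 r1} (hΨ : ∀ j, IsTP (Ψ j)) (hΛ : ∀ j, IsTP (Λ j))
    {Γ : r0 → r0 → LinMap a0 a1} {g : Op r0} (h : Majorizes Ψ Λ Γ g) :
    (n * Fintype.card r0 : ℝ) / Fintype.card r1 ≤ g.trace.re := by
  have h1 := h.1.trace_nonneg
  have h2 : (blockChoi (gapBlock Ψ (fun j => choi (Λ j)) Γ)).trace =
      Fintype.card a0 * (Fintype.card r1 * g.trace - n * Fintype.card r0) := by
    rw [Matrix.trace, Fintype.sum_prod_type]
    simp only [Matrix.diag_apply, blockChoi_gapBlock_apply, if_true, Finset.sum_sub_distrib]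
    rw [mul_sub]
    congr 1
    · simp only [Fintype.sum_prod_type, trace_apply_iff.1 (h.2 _ _), if_true]
      simp [Matrix.trace, Finset.mul_sum, mul_left_comm]
    · rw [Finset.sum_congr rfl fun p _ => Finset.sum_comm, Finset.sum_comm]
      simp_rw [← Finset.mul_sum, ← Finset.sum_mul, Fintype.sum_prod_type, (hΨ _).trace_choi,
        (hΛ _).trace_choi]
      simp
      ring
  rw [h2] at h1
  have ha : (0 : ℝ) < Fintype.card a0 := by exact_mod_cast Fintype.card_pos
  have hr : (0 : ℝ) < Fintype.card r1 := by exact_mod_cast Fintype.card_pos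
  have h3 := (Complex.nonneg_iff.1 h1).1
  have h4 : ((Fintype.card a0 : ℂ) * (Fintype.card r1 * g.trace - n * Fintype.card r0)).re =
      Fintype.card a0 * (Fintype.card r1 * g.trace.re - n * Fintype.card r0) := by
    simp
  rw [h4] at h3
  rw [div_le_iff₀ hr, mul_comm]
  have := nonneg_of_mul_nonneg_right h3 ha
  linarith

omit [DecidableEq a1] in
-- The bound keeps the infimum strictly positive, where the logarithm is monotone.
theorem majorantValues_lower_bound [Nonempty a0] [Nonempty r0] [Nonempty r1] (hn : 0 < n)
    {Ψ : Fin n → LinMap a0 a1} {Λ : Fin n → LinMap r0 r1} (hΨ : ∀ j, IsTP (Ψ j))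
    (hΛ : ∀ j, IsTP (Λ j)) {t : ℝ} (ht : t ∈ majorantValues Ψ Λ) :
    1 / (Fintype.card r1 : ℝ) ≤ t := by
  obtain ⟨Γ, g, h, rfl⟩ := ht
  have h1 := h.le_trace hΨ hΛ
  have hn' : (0 : ℝ) < n := by exact_mod_cast hn
  have hr : (0 : ℝ) < Fintype.card r0 := by exact_mod_cast Fintype.card_pos
  rw [le_div_iff₀ (mul_pos hn' hr)]
  calc _ = (n * Fintype.card r0 : ℝ) / Fintype.card r1 := by ring
    _ ≤ _ := h1

/-- The Choi matrix of `-∑ⱼ Λⱼ ⊗ Ψⱼ` is Hermitian, hence positive after adding `c • 1`, and `c • 1`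
is itself of the form `Γ ⊗ I`. -/
theorem majorantValues_nonempty {Ψ : Fin n → LinMap a0 a1} {Λ : Fin n → LinMap r0 r1}
    (hΨ : ∀ j, IsCP (Ψ j)) (hΛ : ∀ j, IsCP (Λ j)) : (majorantValues Ψ Λ).Nonempty := by
  have hH : (blockChoi (gapBlock Ψ (fun j => choi (Λ j)) 0)).IsHermitian := by
    ext ⟨p, x⟩ ⟨q, y⟩
    simp only [Matrix.conjTranspose_apply, blockChoi_gapBlock_apply, Pi.zero_apply, choi_zero,
      Matrix.zero_apply, ite_self, zero_sub, star_neg, star_sum, star_mul']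
    simp_rw [(isCP_iff_posSemidef_choi.1 (hΨ _)).isHermitian.apply,
      (isCP_iff_posSemidef_choi.1 (hΛ _)).isHermitian.apply]
  obtain ⟨c, -, hc⟩ := hH.exists_add_smul_one_posSemidef
  refine ⟨_, fun ρ ρ' => if ρ = ρ' then ofChoi ((c : ℂ) • 1) else 0,
    Matrix.of fun ρ ρ' => if ρ = ρ' then (c : ℂ) * Fintype.card a1 else 0, ⟨?_, ?_⟩, rfl⟩
  · convert hc c le_rfl using 1
    ext ⟨⟨ρ, r⟩, x⟩ ⟨⟨ρ', r'⟩, y⟩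
    simp only [Matrix.add_apply, Matrix.smul_apply, blockChoi_gapBlock_apply, Pi.zero_apply,
      choi_zero, Matrix.zero_apply, ite_self, zero_sub, smul_eq_mul, Matrix.one_apply,
      Prod.mk.injEq]
    by_cases h1 : ρ = ρ' <;> by_cases h2 : r = r' <;>
      simp [h1, h2, choi_zero, Matrix.one_apply, add_comm, sub_eq_add_neg]
  · intro ρ ρ' X
    by_cases h1 : ρ = ρ'
    · simp only [h1, if_true, Matrix.of_apply]
      revert X
      rw [trace_apply_iff]
      intro i j
      simp only [choi_ofChoi, Matrix.smul_apply, Matrix.one_apply, Prod.mk.injEq, and_true]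
      split_ifs <;> simp [mul_comm]
    · simp [h1]

/-- The identity superchannel bounds the trace of any majorant from below. -/
theorem Majorizes.pairing_le {Φ Λ : Fin n → LinMap b0 b1} {Γ : b0 → b0 → LinMap b0 b1}
    {g : Op b0} (h : Majorizes Φ Λ Γ g) :
    (∑ j, pairing (choi (Φ j)) (choi (Λ j))).re ≤ g.trace.re := by
  -- This is the quadratic form of the gap block at the vector `∑ₚ |p⟩|p⟩`, available because `R`
  -- and `B` have the same basis labels.
  have h1 := ((h.1.submatrix fun x : Unit × (b0 × b1) => (x.2, x.2)).sum_blocks).diag_nonneg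
    (i := ())
  have h2 : ∑ p : b0 × b1, ∑ q : b0 × b1,
      (if p.2 = q.2 then choi (Γ p.1 q.1) p q else 0) = g.trace := by
    simp only [Fintype.sum_prod_type, Finset.sum_ite_eq, Finset.mem_univ, if_true]
    simp_rw [Finset.sum_comm (s := Finset.univ (α := b1)), trace_apply_iff.1 (h.2 _ _)]
    simp [Matrix.trace]
  simp only [Matrix.of_apply, Matrix.submatrix_apply, blockChoi_gapBlock_apply,
    Finset.sum_sub_distrib, h2] at h1
  have h4 := (Complex.nonneg_iff.1 h1).1
  rw [Complex.sub_re, sub_nonneg] at h4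
  convert h4 using 2
  simp only [pairing]
  rw [Finset.sum_comm]
  refine Finset.sum_congr rfl fun p _ => ?_
  rw [Finset.sum_comm]
  exact Finset.sum_congr rfl fun q _ => Finset.sum_congr rfl fun j _ => mul_comm _ _

variable [Nonempty a0] [Nonempty a1] [Nonempty b0] [Nonempty r0] [Nonempty r1]

/-- The extended conditional min-entropy does not decrease under superchannels. -/
theorem hMinExt_mixMap_le_map (hn : 0 < n) {Ψ : Fin n → LinMap a0 a1}
    {Λ : Fin n → LinMap r0 r1} (hΨ : ∀ j, IsChannel (Ψ j)) (hΛ : ∀ j, IsChannel (Λ j))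
    {Θ : SuperMap a0 a1 b0 b1} (hΘ : IsSuperchannel Θ) :
    hMinExt (mixMap Ψ Λ) ≤ hMinExt (mixMap (fun j => Θ (Ψ j)) Λ) := by
  rw [hMinExt_mixMap hn, hMinExt_mixMap hn, neg_le_neg_iff]
  have hne := majorantValues_nonempty (fun j => (hΨ j).1) (fun j => (hΛ j).1)
  have hsub : majorantValues Ψ Λ ⊆ majorantValues (fun j => Θ (Ψ j)) Λ := by
    rintro t ⟨Γ, g, h, rfl⟩
    exact ⟨_, g, h.map hΘ, rfl⟩
  have hlb (t) (ht : t ∈ majorantValues (fun j => Θ (Ψ j)) Λ) :=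
    majorantValues_lower_bound hn (fun j => hΘ.2 _ (hΨ j).2) (fun j => (hΛ j).2) ht
  have hr : (0 : ℝ) < Fintype.card r1 := by exact_mod_cast Fintype.card_pos
  exact Real.logb_le_logb_of_le one_lt_two
    ((one_div_pos.2 hr).trans_le (le_csInf (hne.mono hsub) hlb)) (csInf_le_csInf ⟨_, hlb⟩ hne hsub)

omit [Nonempty a1] in
/-- A majorant for `Ψ` which beats the value of the identity superchannel for `Φ` separates
the min-entropies. -/
theorem hMinExt_mixMap_lt [Nonempty b1] (hn : 0 < n) {Ψ : Fin n → LinMap a0 a1}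
    {Φ Λ : Fin n → LinMap b0 b1} (hΨ : ∀ j, IsChannel (Ψ j)) (hΦ : ∀ j, IsChannel (Φ j))
    (hΛ : ∀ j, IsChannel (Λ j)) {Γ : b0 → b0 → LinMap a0 a1} {g : Op b0}
    (h : Majorizes Ψ Λ Γ g)
    (hg : g.trace.re < (∑ j, pairing (choi (Φ j)) (choi (Λ j))).re) :
    hMinExt (mixMap Φ Λ) < hMinExt (mixMap Ψ Λ) := by
  rw [hMinExt_mixMap hn, hMinExt_mixMap hn, neg_lt_neg_iff]
  have hlb (t) (ht : t ∈ majorantValues Ψ Λ) :=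
    majorantValues_lower_bound hn (fun j => (hΨ j).2) (fun j => (hΛ j).2) ht
  have hne : (majorantValues Ψ Λ).Nonempty := ⟨_, _, _, h, rfl⟩
  have hne' := majorantValues_nonempty (fun j => (hΦ j).1) (fun j => (hΛ j).1)
  have hr : (0 : ℝ) < Fintype.card b1 := by exact_mod_cast Fintype.card_pos
  have hn' : (0 : ℝ) < n * Fintype.card b0 :=
    mul_pos (by exact_mod_cast hn) (by exact_mod_cast Fintype.card_pos)
  refine Real.logb_lt_logb one_lt_two ((one_div_pos.2 hr).trans_le (le_csInf hne hlb)) ?_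
  -- The common bound `∑ⱼ ⟨Φⱼ, Λⱼ⟩ / (n d_{B₀})` lies strictly above one value for `Ψ` and below all
  -- values for `Φ`.
  refine (csInf_le ⟨_, hlb⟩ ⟨_, _, h, rfl⟩).trans_lt
    (((div_lt_div_iff_of_pos_right hn').2 hg).trans_le (le_csInf hne' ?_))
  rintro t ⟨Γ', g', h', rfl⟩
  exact (div_le_div_iff_of_pos_right hn').2 h'.pairing_le

end MinEntropy

/-! ### Separating a point from the image of the positive semidefinite cone -/

section Separation

theorem pairing_add_right {d : Type*} [Fintype d] (X Y Z : Op d) :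
    pairing X (Y + Z) = pairing X Y + pairing X Z := by
  simp [pairing, mul_add, Finset.sum_add_distrib]

theorem pairing_sum_right {ι d : Type*} [Fintype d] (s : Finset ι) (X : Op d) (Y : ι → Op d) :
    pairing X (∑ j ∈ s, Y j) = ∑ j ∈ s, pairing X (Y j) := by
  simp only [pairing, Matrix.sum_apply, Finset.mul_sum]
  simp only [Finset.sum_comm (t := s)]

theorem pairing_smul_right {d : Type*} [Fintype d] (c : ℂ) (X Y : Op d) :
    pairing X (c • Y) = c * pairing X Y := by
  simp [pairing, Finset.mul_sum, mul_left_comm]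

theorem pairing_conjTranspose {d : Type*} [Fintype d] (X Y : Op d) :
    pairing X.conjTranspose Y.conjTranspose = star (pairing X Y) := by
  simp only [pairing, Matrix.conjTranspose_apply, star_sum, star_mul']
  exact Finset.sum_comm

/-- Every real functional is, on Hermitian matrices, the pairing with a Hermitian matrix. -/
theorem exists_isHermitian_pairing {d : Type*} [Fintype d] [DecidableEq d]
    (f : Op d →ₗ[ℝ] ℝ) :
    ∃ N : Op d, N.IsHermitian ∧ ∀ X : Op d, X.IsHermitian → f X = (pairing X N).re := by
  -- The real part of `(x + iy)(f(E) - i f(iE))` is `x f(E) + y f(iE)`, which recovers `f` on each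
  -- matrix unit `E`.
  let N : Op d := Matrix.of fun p q =>
    (f (Matrix.single p q 1) : ℂ) - f (Matrix.single p q Complex.I) * Complex.I
  have hN (X : Op d) : f X = (pairing X N).re := by
    conv_lhs => rw [Matrix.matrix_eq_sum_single X]
    simp only [map_sum, pairing, Complex.re_sum]
    refine Finset.sum_congr rfl fun p _ => Finset.sum_congr rfl fun q _ => ?_
    have h1 : Matrix.single p q (X p q) = (X p q).re • Matrix.single p q (1 : ℂ) +
        (X p q).im • Matrix.single p q Complex.I := by
      rw [Matrix.smul_single, Matrix.smul_single, ← Matrix.single_add]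
      congr 1
      simp [Complex.re_add_im]
    rw [h1, map_add, map_smul, map_smul]
    simp [N]
  -- On a Hermitian `X` the pairings with `N` and its adjoint are complex conjugates, so the
  -- Hermitian part of `N` gives the same real part.
  refine ⟨(1 / 2 : ℂ) • (N + N.conjTranspose), ?_, fun X hX => ?_⟩
  · ext p q
    simp [add_comm, mul_add]
  · have h1 : pairing X N.conjTranspose = star (pairing X N) := by
      rw [← pairing_conjTranspose, hX.eq]
    rw [pairing_smul_right, pairing_add_right, h1, hN]
    simp
    ring

open scoped MatrixOrder Matrix.Norms.L2Operator in
theorem Matrix.PosSemidef.exists_conjTranspose_mul_self {d : Type*} [Fintype d] [DecidableEq d]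
    {X : Op d} (hX : X.PosSemidef) : ∃ B : Op d, X = B.conjTranspose * B :=
  CStarAlgebra.nonneg_iff_eq_star_mul_self.1 (Matrix.nonneg_iff_posSemidef.2 hX)

/-- The positive semidefinite matrices of given trace form a compact set. -/
theorem isCompact_posSemidef_trace {d : Type*} [Fintype d] [DecidableEq d] (t : ℝ) :
    IsCompact {X : Op d | X.PosSemidef ∧ X.trace.re = t} := by
  have hc : IsCompact {B : Op d | (B.conjTranspose * B).trace.re = t} := by
    have hK : IsCompact (Set.univ.pi fun _ : d => Set.univ.pi fun _ : d =>
        Metric.closedBall (0 : ℂ) √t) :=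
      isCompact_univ_pi fun _ => isCompact_univ_pi fun _ => isCompact_closedBall _ _
    refine IsCompact.of_isClosed_subset (X := d → d → ℂ) hK ?_ ?_
    · have h : Continuous fun B : Op d => (B.conjTranspose * B).trace.re := by fun_prop
      exact isClosed_singleton.preimage h
    · intro B' hB i _ j _
      let B : Op d := B'
      change B i j ∈ _
      rw [mem_closedBall_zero_iff]
      apply Real.le_sqrt_of_sq_le
      rw [← (hB : Complex.re (Matrix.trace (Matrix.conjTranspose B * B)) = t)]
      have h1 : (Matrix.trace (Matrix.conjTranspose B * B : Op d)).re =
          ∑ l, ∑ k, ‖B k l‖ ^ 2 := by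
        simp only [Matrix.trace, Matrix.diag_apply, Matrix.mul_apply, Matrix.conjTranspose_apply,
          Complex.re_sum]
        refine Finset.sum_congr rfl fun l _ => Finset.sum_congr rfl fun k _ => ?_
        rw [Complex.star_def, ← Complex.normSq_eq_conj_mul_self, Complex.ofReal_re,
          Complex.normSq_eq_norm_sq]
      rw [h1]
      exact (Finset.single_le_sum (f := fun k => ‖B k j‖ ^ 2) (fun _ _ => sq_nonneg _)
        (Finset.mem_univ i)).trans (Finset.single_le_sum (f := fun l => ∑ k, ‖B k l‖ ^ 2)
          (fun _ _ => Finset.sum_nonneg fun _ _ => sq_nonneg _) (Finset.mem_univ j))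
  have hi : {X : Op d | X.PosSemidef ∧ X.trace.re = t} =
      (fun B : Op d => B.conjTranspose * B) '' {B : Op d | (B.conjTranspose * B).trace.re = t} := by
    ext X
    constructor
    · rintro ⟨hX, rfl⟩
      obtain ⟨B, rfl⟩ := hX.exists_conjTranspose_mul_self
      exact ⟨B, rfl, rfl⟩
    · rintro ⟨B, hB, rfl⟩
      exact ⟨Matrix.posSemidef_conjTranspose_mul_self B, hB⟩
  rw [hi]
  exact hc.image (by fun_prop)

/-- A Farkas lemma for the cone of positive semidefinite matrices. -/
theorem exists_functional_of_not_mem_image_posSemidef {d : Type*} [Fintype d] [DecidableEq d]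
    {E : Type*} [NormedAddCommGroup E] [NormedSpace ℝ E] (L : Op d →ₗ[ℝ] E) (ℓ : E →ₗ[ℝ] ℝ)
    (hℓ : ∀ X, ℓ (L X) = X.trace.re) {b : E} (hb : 0 < ℓ b)
    (h : ∀ X : Op d, X.PosSemidef → L X ≠ b) :
    ∃ f : E →ₗ[ℝ] ℝ, (∀ X : Op d, X.PosSemidef → 0 ≤ f (L X)) ∧ f b < 0 := by
  -- Since `ℓ ∘ L` is the trace, any positive preimage of `b` has trace `ℓ b`. Only this compact
  -- slice matters, so its image is closed and no interior-point condition is needed.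
  set S : Set (Op d) := {X : Op d | X.PosSemidef ∧ X.trace.re = ℓ b} with hS
  have hSc : Convex ℝ S := by
    intro X hX Y hY s t hs ht hst
    refine ⟨(hX.1.smul hs).add (hY.1.smul ht), ?_⟩
    have h1 := hX.2
    have h2 := hY.2
    simp only [Matrix.trace_add, Matrix.trace_smul, Complex.add_re, Complex.smul_re, h1, h2,
      smul_eq_mul]
    rw [← add_mul, hst, one_mul]
  have hLc : Continuous L := L.continuous_of_finiteDimensional
  have hcl : IsClosed (L '' S) := ((isCompact_posSemidef_trace _).image hLc).isClosed
  have hnot : b ∉ L '' S := by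
    rintro ⟨X, hX, hXb⟩
    exact h X hX.1 hXb
  obtain ⟨f, u, hfb, hfS⟩ := geometric_hahn_banach_point_closed
    (hSc.is_linear_image L.isLinear) hcl hnot
  -- The subtracted functional equals `u` wherever `ℓ` equals `ℓ b`, which moves the separating
  -- threshold to 0; scaling then extends the bound from the slice to the cone.
  refine ⟨(f : E →ₗ[ℝ] ℝ) - (u / ℓ b) • ℓ, fun X hX => ?_, ?_⟩
  · have hval : ((f : E →ₗ[ℝ] ℝ) - (u / ℓ b) • ℓ) (L X) = f (L X) - u / ℓ b * X.trace.re := by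
      simp [hℓ]
    rw [hval]
    have htr := (Complex.nonneg_iff.1 hX.trace_nonneg).1
    rcases htr.eq_or_lt with h0 | h0
    · have : X.trace = 0 :=
        Complex.ext h0.symm (Complex.nonneg_iff.1 hX.trace_nonneg).2.symm
      rw [hX.trace_eq_zero_iff] at this
      simp [this]
    · have h1 := hfS (L ((ℓ b / X.trace.re) • X))
        ⟨_, ⟨hX.smul (div_nonneg hb.le htr), by
          simp [Matrix.trace_smul, h0.ne']⟩, rfl⟩
      rw [map_smul, map_smul, smul_eq_mul, div_mul_eq_mul_div, lt_div_iff₀ h0] at h1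
      rw [sub_nonneg, div_mul_eq_mul_div, div_le_iff₀ hb]
      linarith
  · simp only [LinearMap.sub_apply, LinearMap.smul_apply, smul_eq_mul,
      div_mul_cancel₀ _ hb.ne', ContinuousLinearMap.coe_coe]
    linarith

theorem exists_functional_prod_pi {n : ℕ} {E₁ E₂ E₃ : Type*} [AddCommGroup E₁] [Module ℝ E₁]
    [AddCommGroup E₂] [Module ℝ E₂] [AddCommGroup E₃] [Module ℝ E₃]
    (f : E₁ × E₂ × (Fin n → E₃) →ₗ[ℝ] ℝ) :
    ∃ (f₁ : E₁ →ₗ[ℝ] ℝ) (f₂ : E₂ →ₗ[ℝ] ℝ) (f₃ : Fin n → E₃ →ₗ[ℝ] ℝ),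
      ∀ x y w, f (x, y, w) = f₁ x + f₂ y + ∑ j, f₃ j (w j) := by
  refine ⟨f ∘ₗ .inl ℝ _ _, f ∘ₗ .inr ℝ _ _ ∘ₗ .inl ℝ _ _,
    fun j => f ∘ₗ .inr ℝ _ _ ∘ₗ .inr ℝ _ _ ∘ₗ .single ℝ (fun _ : Fin n => E₃) j, fun x y w => ?_⟩
  have h3 : ∑ j, f (0, 0, Pi.single j (w j)) = f (0, 0, w) := by
    have := map_sum (f ∘ₗ .inr ℝ E₁ _ ∘ₗ .inr ℝ E₂ _) (fun j => Pi.single j (w j)) Finset.univ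
    rw [Finset.univ_sum_single] at this
    simpa using this.symm
  simp only [LinearMap.coe_comp, Function.comp_apply, LinearMap.inl_apply, LinearMap.inr_apply,
    LinearMap.single_apply, h3]
  rw [← map_add, ← map_add]
  simp

end Separation

/-! ### Linear constraints on superchannels and their dual -/

section Comb

variable {n : ℕ} {a0 a1 b0 b1 : Type*} [Fintype a0] [DecidableEq a0] [Fintype a1]
  [DecidableEq a1] [Fintype b0] [DecidableEq b0] [Fintype b1] [DecidableEq b1]

/-- The partial trace over `B₁` of the Choi matrix of a supermap. -/
def traceOut {x : Type*} : Op ((b0 × b1) × x) →ₗ[ℝ] Op (b0 × x) where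
  toFun J := Matrix.of fun p q => ∑ δ, J ((p.1, δ), p.2) ((q.1, δ), q.2)
  map_add' X Y := by ext; simp [Finset.sum_add_distrib]
  map_smul' c X := by ext; simp [Finset.mul_sum]

/-- The map `T ↦ d_{A₁} T - Tr_{A₁} T ⊗ I^{A₁}`, which vanishes on the operators of the form
`T' ⊗ I^{A₁}`. -/
def combDefect : Op (b0 × (a0 × a1)) →ₗ[ℝ] Op (b0 × (a0 × a1)) where
  toFun T := Matrix.of fun p q => Fintype.card a1 * T p q -
    if p.2.2 = q.2.2 then ∑ κ, T (p.1, (p.2.1, κ)) (q.1, (q.2.1, κ)) else 0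
  map_add' X Y := by
    ext p q
    by_cases h : p.2.2 = q.2.2 <;> simp [h, Finset.sum_add_distrib]
    all_goals ring
  map_smul' c X := by
    ext p q
    by_cases h : p.2.2 = q.2.2 <;> simp [h, Finset.mul_sum, mul_sub, mul_left_comm]

/-- The partial trace over the second factor, as a real linear map. -/
def traceSnd {x : Type*} [Fintype x] : Op (b0 × x) →ₗ[ℝ] Op b0 where
  toFun T := Matrix.of fun β β' => ∑ x, T (β, x) (β', x)
  map_add' X Y := by ext; simp [Finset.sum_add_distrib]
  map_smul' c X := by ext; simp [Finset.mul_sum]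

omit [Fintype b0] [DecidableEq b0] [DecidableEq b1] in
theorem Matrix.IsHermitian.traceOut {x : Type*} {J : Op ((b0 × b1) × x)} (hJ : J.IsHermitian) :
    (traceOut J).IsHermitian := by
  ext p q
  simp only [_root_.traceOut, LinearMap.coe_mk, AddHom.coe_mk, Matrix.conjTranspose_apply,
    Matrix.of_apply, star_sum, hJ.apply]

omit [Fintype a0] [DecidableEq a0] [Fintype b0] [DecidableEq b0] in
theorem Matrix.IsHermitian.combDefect {T : Op (b0 × (a0 × a1))} (hT : T.IsHermitian) :
    (combDefect T).IsHermitian := by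
  ext p q
  simp only [_root_.combDefect, LinearMap.coe_mk, AddHom.coe_mk, Matrix.conjTranspose_apply,
    Matrix.of_apply, star_sub, star_mul', hT.apply, apply_ite star, star_sum, star_zero,
    star_natCast, eq_comm]

omit [Fintype b0] [DecidableEq b0] in
theorem Matrix.IsHermitian.traceSnd {x : Type*} [Fintype x] {T : Op (b0 × x)}
    (hT : T.IsHermitian) : (traceSnd T).IsHermitian := by
  ext p q
  simp only [_root_.traceSnd, LinearMap.coe_mk, AddHom.coe_mk, Matrix.conjTranspose_apply,
    Matrix.of_apply, star_sum, hT.apply]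

omit [DecidableEq b0] in
-- This and the next pairing formulas compute adjoints of the constraint maps: partial traces become
-- tensoring with the identity, and `combDefect` is self-adjoint.
theorem pairing_traceOut {x : Type*} [Fintype x] (J : Op ((b0 × b1) × x)) (H : Op (b0 × x)) :
    pairing (traceOut J) H = pairing J (Matrix.of fun p q =>
      if p.1.2 = q.1.2 then H (p.1.1, p.2) (q.1.1, q.2) else 0) := by
  simp only [pairing, traceOut, LinearMap.coe_mk, AddHom.coe_mk, Matrix.of_apply,
    Fintype.sum_prod_type, mul_ite, mul_zero, Finset.sum_mul]
  refine Finset.sum_congr rfl fun β _ => ?_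
  rw [Finset.sum_comm (s := Finset.univ (α := b1))]
  refine Finset.sum_congr rfl fun ξ _ => ?_
  rw [Finset.sum_comm (s := Finset.univ (α := b1))]
  refine Finset.sum_congr rfl fun β' _ => ?_
  rw [Finset.sum_comm]
  refine Finset.sum_congr rfl fun δ _ => ?_
  rw [Finset.sum_comm]
  simp

omit [DecidableEq a0] [DecidableEq b0] in
theorem pairing_combDefect (T G : Op (b0 × (a0 × a1))) :
    pairing (combDefect T) G = pairing T (combDefect G) := by
  simp only [pairing, combDefect, LinearMap.coe_mk, AddHom.coe_mk, Matrix.of_apply,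
    sub_mul, mul_sub, Finset.sum_sub_distrib]
  congr 1
  · refine Finset.sum_congr rfl fun p _ => Finset.sum_congr rfl fun q _ => ?_
    ring
  · simp only [Fintype.sum_prod_type, ite_mul, zero_mul, mul_ite, mul_zero, Finset.sum_ite_eq,
      Finset.mem_univ, if_true]
    refine Finset.sum_congr rfl fun β _ => Finset.sum_congr rfl fun α _ => ?_
    rw [Finset.sum_comm, Finset.sum_comm (s := Finset.univ (α := a1))]
    refine Finset.sum_congr rfl fun β' _ => ?_
    rw [Finset.sum_comm, Finset.sum_comm (s := Finset.univ (α := a1))]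
    refine Finset.sum_congr rfl fun α' _ => ?_
    rw [← Finset.mul_sum, ← Finset.sum_mul]

omit [DecidableEq b0] in
theorem pairing_traceSnd {x : Type*} [Fintype x] [DecidableEq x] (T : Op (b0 × x)) (Y : Op b0) :
    pairing (traceSnd T) Y =
      pairing T (Matrix.of fun p q => if p.2 = q.2 then Y p.1 q.1 else 0) := by
  simp only [pairing, traceSnd, LinearMap.coe_mk, AddHom.coe_mk, Matrix.of_apply,
    Fintype.sum_prod_type, mul_ite, mul_zero, Finset.sum_mul, Finset.sum_ite_eq,
    Finset.mem_univ, if_true]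
  exact Finset.sum_congr rfl fun β _ => Finset.sum_comm

omit [DecidableEq a1] [DecidableEq b1] in
theorem pairing_choi_superOfChoi (J : Op ((b0 × b1) × (a0 × a1))) (Ψ : LinMap a0 a1)
    (W : Op (b0 × b1)) :
    pairing (choi (superOfChoi J Ψ)) W = pairing J (W ⊗ₖ choi Ψ) := by
  simp only [pairing, choi_superOfChoi, Fintype.sum_prod_type (α₁ := b0 × b1), Finset.sum_mul,
    Matrix.kronecker_apply]
  refine Finset.sum_congr rfl fun p _ => ?_
  rw [Finset.sum_comm]
  refine Finset.sum_congr rfl fun x _ => Finset.sum_congr rfl fun q _ =>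
    Finset.sum_congr rfl fun x' _ => ?_
  ring

/-- The linear constraints on the Choi matrix of a superchannel taking `Ψⱼ` to given maps. -/
def combConstraints (Ψ : Fin n → LinMap a0 a1) : Op ((b0 × b1) × (a0 × a1)) →ₗ[ℝ]
    Op (b0 × (a0 × a1)) × Op b0 × (Fin n → Op (b0 × b1)) where
  toFun J := (combDefect (traceOut J), traceSnd (traceOut J), fun j => choi (superOfChoi J (Ψ j)))
  map_add' X Y := by
    refine Prod.ext (by simp) (Prod.ext (by simp) ?_)
    funext j
    ext
    simp [choi_superOfChoi, add_mul, Finset.sum_add_distrib]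
  map_smul' c X := by
    refine Prod.ext (by simp) (Prod.ext (by simp) ?_)
    funext j
    ext
    simp [choi_superOfChoi, Finset.mul_sum, mul_assoc]

/-- Vanishing of `combDefect` forces `Tr_{B₁} J = K ⊗ I` with `K` the average of `Tr_{B₁} J` over
`A₁`. The target `d_{A₁} • 1` then normalizes `Tr_{A₀} K` to the identity. -/
theorem isSuperchannel_of_combConstraints [Nonempty a1] {Ψ : Fin n → LinMap a0 a1}
    {Φ : Fin n → LinMap b0 b1} {J : Op ((b0 × b1) × (a0 × a1))} (hJ : J.PosSemidef)
    (h : combConstraints Ψ J = (0, (Fintype.card a1 : ℂ) • 1, fun j => choi (Φ j))) :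
    IsSuperchannel (superOfChoi J) ∧ ∀ j, Φ j = superOfChoi J (Ψ j) := by
  have ha : (Fintype.card a1 : ℂ) ≠ 0 := by exact_mod_cast Fintype.card_ne_zero
  simp only [combConstraints, LinearMap.coe_mk, AddHom.coe_mk, Prod.mk.injEq] at h
  obtain ⟨h1, h2, h3⟩ := h
  refine ⟨⟨isCompletelyCPP_superOfChoi hJ, isTPP_superOfChoi
    (Matrix.of fun p q => (Fintype.card a1 : ℂ)⁻¹ *
      ∑ κ, traceOut J (p.1, (p.2, κ)) (q.1, (q.2, κ))) ?_ ?_⟩,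
    fun j => choi_injective (congrFun h3 j).symm⟩
  · intro β β' α α' κ κ'
    have h4 := congrFun (congrFun h1 (β, (α, κ))) (β', (α', κ'))
    simp only [combDefect, LinearMap.coe_mk, AddHom.coe_mk, Matrix.of_apply, Matrix.zero_apply,
      sub_eq_zero] at h4
    change traceOut J (β, (α, κ)) (β', (α', κ')) = _
    rw [← inv_mul_cancel_left₀ ha (traceOut J (β, (α, κ)) (β', (α', κ'))), h4]
    split_ifs <;> simp
  · intro β β'
    have h4 := congrFun (congrFun h2 β) β'
    simp only [traceSnd, LinearMap.coe_mk, AddHom.coe_mk, Matrix.of_apply, Fintype.sum_prod_type,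
      Matrix.smul_apply, Matrix.one_apply, smul_eq_mul] at h4
    simp only [Matrix.of_apply, ← Finset.mul_sum, h4, inv_mul_cancel_left₀ ha]

open scoped Matrix.Norms.Elementwise in
/-- If no superchannel takes `Ψⱼ` to `Φⱼ` for all `j`, then there is a dual certificate. -/
theorem exists_dual_certificate [Nonempty a1] [Nonempty b0] {Ψ : Fin n → LinMap a0 a1}
    {Φ : Fin n → LinMap b0 b1} (hΨ : ∀ j, IsCP (Ψ j)) (hΦ : ∀ j, IsCP (Φ j))
    (h : ¬ ∃ Θ : SuperMap a0 a1 b0 b1, IsSuperchannel Θ ∧ ∀ j, Φ j = Θ (Ψ j)) :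
    ∃ (M : Fin n → Op (b0 × b1)) (Γ : b0 → b0 → LinMap a0 a1) (g : Op b0),
      (∀ j, (M j).IsHermitian) ∧ (blockChoi (gapBlock Ψ M Γ)).PosSemidef ∧
      (∀ β β' X, (Γ β β' X).trace = g β β' * X.trace) ∧
      g.trace.re < (∑ j, pairing (choi (Φ j)) (M j)).re := by
  let ℓ : Op (b0 × (a0 × a1)) × Op b0 × (Fin n → Op (b0 × b1)) →ₗ[ℝ] ℝ :=
    { toFun := fun z => z.2.1.trace.re
      map_add' := fun x y => by simp
      map_smul' := fun c x => by simp }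
  obtain ⟨f, hf, hfb⟩ := exists_functional_of_not_mem_image_posSemidef (combConstraints Ψ) ℓ
    (b := (0, (Fintype.card a1 : ℂ) • 1, fun j => choi (Φ j))) (fun X => by
      change (traceSnd (traceOut X)).trace.re = _
      simp only [traceSnd, traceOut, LinearMap.coe_mk, AddHom.coe_mk, Matrix.trace,
        Matrix.diag_apply, Matrix.of_apply, Fintype.sum_prod_type]
      congr 1
      refine Finset.sum_congr rfl fun β _ => ?_
      simp_rw [Finset.sum_comm (s := Finset.univ (α := b1))])
    (by
      simp only [ℓ, LinearMap.coe_mk, AddHom.coe_mk, Matrix.trace_smul, Matrix.trace_one]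
      rw [smul_eq_mul, ← Nat.cast_mul, Complex.natCast_re]
      exact_mod_cast Nat.mul_pos Fintype.card_pos Fintype.card_pos)
    (fun X hX hX' => h ⟨_, isSuperchannel_of_combConstraints hX hX'⟩)
  obtain ⟨f₁, f₂, f₃, hf'⟩ := exists_functional_prod_pi f
  obtain ⟨G, hG, hfG⟩ := exists_isHermitian_pairing f₁
  obtain ⟨Y, hY, hfY⟩ := exists_isHermitian_pairing f₂
  choose W hW hfW using fun j => exists_isHermitian_pairing (f₃ j)
  have hΨH j := (isCP_iff_posSemidef_choi.1 (hΨ j)).isHermitian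
  have hΦH j := (isCP_iff_posSemidef_choi.1 (hΦ j)).isHermitian
  -- The dual variables of the two comb constraints, pulled back by the adjoints, form the part of
  -- the dual operator that is the identity on `B₁`.
  let Γ : b0 → b0 → LinMap a0 a1 := fun β β' => ofChoi (Matrix.of fun x y =>
    combDefect G (β, x) (β', y) + if x = y then Y β β' else 0)
  have hpair (J : Op ((b0 × b1) × (a0 × a1))) :
      pairing J (blockChoi (gapBlock Ψ (fun j => - W j) Γ)) =
      pairing (combDefect (traceOut J)) G + pairing (traceSnd (traceOut J)) Y +
        ∑ j, pairing (choi (superOfChoi J (Ψ j))) (W j) := by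
    simp only [pairing_combDefect, pairing_traceSnd, pairing_traceOut, pairing_choi_superOfChoi]
    rw [← pairing_sum_right, ← pairing_add_right, ← pairing_add_right]
    congr 1
    ext ⟨p, x⟩ ⟨q, y⟩
    rw [blockChoi_gapBlock_apply]
    simp only [Γ, choi_ofChoi, Matrix.add_apply, Matrix.of_apply, Matrix.sum_apply,
      Matrix.kronecker_apply, Matrix.neg_apply, neg_mul, Finset.sum_neg_distrib, sub_neg_eq_add]
    congr 1
    by_cases hpq : p.2 = q.2 <;> simp [hpq]
  have hZH : (blockChoi (gapBlock Ψ (fun j => - W j) Γ)).IsHermitian := by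
    ext ⟨p, x⟩ ⟨q, y⟩
    simp only [Matrix.conjTranspose_apply, blockChoi_gapBlock_apply, Γ, choi_ofChoi,
      Matrix.of_apply, star_sub, apply_ite star, star_add, star_zero, hG.combDefect.apply,
      hY.apply, star_sum, star_mul', Matrix.neg_apply, star_neg, (hW _).apply, (hΨH _).apply,
      eq_comm]
  refine ⟨fun j => - W j, Γ, (Fintype.card a1 : ℂ) • Y, fun j => (hW j).neg, ?_, ?_, ?_⟩
  · refine hZH.posSemidef_of_pairing fun J hJ => ?_
    have h1 := hf J hJ
    rw [show combConstraints Ψ J = (combDefect (traceOut J), traceSnd (traceOut J),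
        fun j => choi (superOfChoi J (Ψ j))) from rfl, hf',
      hfG _ hJ.isHermitian.traceOut.combDefect, hfY _ hJ.isHermitian.traceOut.traceSnd] at h1
    rw [hpair, Complex.add_re, Complex.add_re, Complex.re_sum]
    convert h1 using 2
    refine Finset.sum_congr rfl fun j _ => (hfW _ _ ?_).symm
    ext y y'
    simp only [Matrix.conjTranspose_apply, choi_superOfChoi, star_sum, star_mul',
      hJ.isHermitian.apply, (hΨH j).apply]
    exact Finset.sum_comm
  -- `combDefect G` has zero partial trace over `A₁`, so only `d_{A₁} Y` survives; this is why `g`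
  -- has that value.
  · intro β β'
    rw [trace_apply_iff]
    intro α α'
    simp only [Γ, choi_ofChoi, Matrix.of_apply, combDefect, LinearMap.coe_mk, AddHom.coe_mk,
      if_true, Finset.sum_add_distrib, Finset.sum_sub_distrib, Prod.mk.injEq, and_true,
      Finset.sum_const, Finset.card_univ, nsmul_eq_mul, Matrix.smul_apply, smul_eq_mul,
      ← Finset.mul_sum, sub_self, zero_add, mul_ite, mul_zero]
  -- The value `f b = d_{A₁} Tr Y + ∑ⱼ ⟨Φⱼ, Wⱼ⟩` is negative, which is the claim with `Mⱼ = -Wⱼ`.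
  · rw [hf', map_zero, hfY _ (by simp [Matrix.IsHermitian])] at hfb
    simp_rw [hfW _ _ (hΦH _)] at hfb
    have h1 : pairing ((Fintype.card a1 : ℂ) • (1 : Op b0)) Y =
        ((Fintype.card a1 : ℂ) • Y).trace := by
      simp [pairing, Matrix.one_apply, Matrix.trace]
    have h2 : (∑ j, pairing (choi (Φ j)) (- W j)).re =
        - ∑ j, (pairing (choi (Φ j)) (W j)).re := by
      simp [pairing]
    rw [h1] at hfb
    rw [h2]
    linarith

end Comb

/-! ### From a dual certificate to channels of the reference system -/

section Completeness

variable {n : ℕ} {a0 a1 b0 b1 r0 r1 : Type*} [Fintype a0] [DecidableEq a0] [Fintype a1]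
  [DecidableEq a1] [Fintype b0] [DecidableEq b0] [Fintype b1] [DecidableEq b1]

theorem pairing_one_kronecker {Ψ : LinMap b0 b1} (hΨ : IsTP Ψ) (Z : Op b0) :
    pairing (choi Ψ) (Matrix.of fun p q => if p.2 = q.2 then Z p.1 q.1 else 0) = Z.trace := by
  simp only [pairing, Matrix.of_apply, Fintype.sum_prod_type, mul_ite, mul_zero,
    Finset.sum_ite_eq, Finset.mem_univ, if_true]
  simp_rw [Finset.sum_comm (s := Finset.univ (α := b1)), ← Finset.sum_mul, isTP_iff.1 hΨ]
  simp [Matrix.trace]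

omit [DecidableEq a1] in
/-- The operators of a dual certificate can be replaced by Choi matrices of channels. -/
theorem exists_channels_majorizes [Nonempty b0] [Nonempty b1] {Ψ : Fin n → LinMap a0 a1}
    {Φ : Fin n → LinMap b0 b1} (hΨ : ∀ j, IsTP (Ψ j)) (hΦ : ∀ j, IsTP (Φ j))
    {M : Fin n → Op (b0 × b1)} {Γ : b0 → b0 → LinMap a0 a1} {g : Op b0}
    (hM : ∀ j, (M j).IsHermitian) (hP : (blockChoi (gapBlock Ψ M Γ)).PosSemidef)
    (hΓ : ∀ β β' X, (Γ β β' X).trace = g β β' * X.trace)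
    (hg : g.trace.re < (∑ j, pairing (choi (Φ j)) (M j)).re) :
    ∃ (Λ : Fin n → LinMap b0 b1) (Γ' : b0 → b0 → LinMap a0 a1) (g' : Op b0),
      (∀ j, IsChannel (Λ j)) ∧ Majorizes Ψ Λ Γ' g' ∧
      g'.trace.re < (∑ j, pairing (choi (Φ j)) (choi (Λ j))).re := by
  have hd : (0 : ℝ) < Fintype.card b1 := by exact_mod_cast Fintype.card_pos
  have hd' : (Fintype.card b1 : ℂ) ≠ 0 := by exact_mod_cast Fintype.card_ne_zero
  let S : Fin n → Op b0 := fun j => traceSnd (M j)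
  -- `H j` is `M j` with its partial trace over `B₁` removed.
  let H : Fin n → Op (b0 × b1) := fun j => M j - Matrix.of fun p q =>
    if p.2 = q.2 then (Fintype.card b1 : ℂ)⁻¹ * S j p.1 q.1 else 0
  have hH j : (H j).IsHermitian := by
    ext p q
    simp only [H, S, Matrix.conjTranspose_apply, Matrix.sub_apply, Matrix.of_apply, star_sub,
      (hM j).apply, apply_ite star, star_mul', star_inv₀, star_natCast, (hM j).traceSnd.apply,
      star_zero, eq_comm]
  choose c₀ hc₀ hc₀' using fun j => (hH j).exists_add_smul_one_posSemidef
  -- One constant serves all `j`; the summand 1 makes it strictly positive.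
  let c : ℝ := 1 + ∑ j, c₀ j
  have hc : 0 < c := by
    have := Finset.sum_nonneg fun j (_ : j ∈ Finset.univ) => hc₀ j
    simp only [c]
    linarith
  have hcj j : c₀ j ≤ c :=
    (Finset.single_le_sum (fun j _ => hc₀ j) (Finset.mem_univ j)).trans (by simp [c])
  -- With this choice `M j + Z j ⊗ I` equals `H j + c • 1`: positive semidefinite, with partial
  -- trace `c d_{B₁} • 1`.
  let Z : Fin n → Op b0 := fun j => (c : ℂ) • 1 - (Fintype.card b1 : ℂ)⁻¹ • S j
  let M' : Fin n → Op (b0 × b1) := fun j => M j + Matrix.of fun p q =>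
    if p.2 = q.2 then Z j p.1 q.1 else 0
  have hM' j : (M' j).PosSemidef := by
    convert hc₀' j c (hcj j) using 1
    ext ⟨β, δ⟩ ⟨β', δ'⟩
    by_cases h1 : δ = δ' <;> simp [M', H, Z, h1, Matrix.one_apply]
    ring
  have hM'tr j β β' : ∑ δ, M' j (β, δ) (β', δ) =
      if β = β' then (c * Fintype.card b1 : ℂ) else 0 := by
    have hZ : Z j β β' = (if β = β' then (c : ℂ) else 0) -
        (Fintype.card b1 : ℂ)⁻¹ * ∑ δ, M j (β, δ) (β', δ) := by
      simp [Z, S, traceSnd, Matrix.one_apply]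
    simp only [M', Matrix.add_apply, Matrix.of_apply, if_true, Finset.sum_add_distrib,
      Finset.sum_const, Finset.card_univ, nsmul_eq_mul, hZ, mul_sub, mul_inv_cancel_left₀ hd']
    split_ifs <;> ring
  let s : ℝ := (c * Fintype.card b1)⁻¹
  have hs : 0 < s := inv_pos.2 (mul_pos hc hd)
  have hs' : (s : ℂ) * (c * Fintype.card b1) = 1 := by
    have : s * (c * Fintype.card b1) = 1 := inv_mul_cancel₀ (mul_pos hc hd).ne'
    exact_mod_cast this
  -- Adding `∑ⱼ Zⱼ Ψⱼ` to `Γ` cancels the change of the `Mⱼ`, so the gap block is only rescaled by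
  -- `s`. As the `Ψⱼ` are trace preserving, `g` gains `∑ⱼ Zⱼ`.
  refine ⟨fun j => ofChoi ((s : ℂ) • M' j),
    fun β β' => (s : ℂ) • (Γ β β' + ∑ j, Z j β β' • Ψ j), (s : ℂ) • (g + ∑ j, Z j),
    fun j => ⟨?_, ?_⟩, ⟨?_, fun β β' X => ?_⟩, ?_⟩
  · rw [isCP_iff_posSemidef_choi, choi_ofChoi]
    exact (hM' j).smul (by exact_mod_cast hs.le)
  · rw [isTP_iff]
    intro β β'
    simp only [choi_ofChoi, Matrix.smul_apply, smul_eq_mul, ← Finset.mul_sum, hM'tr, mul_ite,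
      hs', mul_zero]
  · convert hP.smul (show (0 : ℂ) ≤ s by exact_mod_cast hs.le) using 1
    ext ⟨p, x⟩ ⟨q, y⟩
    simp only [Matrix.smul_apply, blockChoi_gapBlock_apply, choi_ofChoi, choi_smul, choi_add,
      choi_sum, Matrix.add_apply, Matrix.sum_apply, smul_eq_mul, M', Matrix.of_apply]
    split_ifs
    · simp only [mul_add, add_mul, Finset.sum_add_distrib, Finset.mul_sum, mul_sub, mul_assoc]
      ring
    · simp only [add_zero, zero_sub, mul_neg, Finset.mul_sum, mul_assoc]
  · simp only [LinearMap.smul_apply, LinearMap.add_apply, LinearMap.sum_apply,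
      Matrix.trace_smul, Matrix.trace_add, Matrix.trace_sum, hΓ, hΨ _ X, smul_eq_mul,
      Matrix.smul_apply, Matrix.add_apply, Matrix.sum_apply, ← Finset.sum_mul]
    ring
  · simp only [choi_ofChoi, pairing_smul_right, M', pairing_add_right,
      pairing_one_kronecker (hΦ _), ← Finset.mul_sum, Matrix.trace_smul, smul_eq_mul,
      Complex.re_ofReal_mul, Matrix.trace_add, Matrix.trace_sum, Finset.sum_add_distrib,
      Complex.add_re]
    exact mul_lt_mul_of_pos_left (by linarith) hs

variable [Nonempty a0] [Nonempty a1] [Nonempty b0] [Nonempty b1]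

/-- The min-entropies of mixtures with channels of the reference system characterize the
existence of a superchannel. -/
theorem exists_superchannel_iff_hMinExt_le (hn : 0 < n) {Ψ : Fin n → LinMap a0 a1}
    {Φ : Fin n → LinMap b0 b1} (hΨ : ∀ j, IsChannel (Ψ j)) (hΦ : ∀ j, IsChannel (Φ j)) :
    (∃ Θ : SuperMap a0 a1 b0 b1, IsSuperchannel Θ ∧ ∀ j, Φ j = Θ (Ψ j)) ↔
      ∀ Λ : Fin n → LinMap b0 b1, (∀ j, IsChannel (Λ j)) →
        hMinExt (mixMap Ψ Λ) ≤ hMinExt (mixMap Φ Λ) := by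
  constructor
  · rintro ⟨Θ, hΘ, h⟩ Λ hΛ
    rw [funext h]
    exact hMinExt_mixMap_le_map hn hΨ hΛ hΘ
  · intro h
    by_contra hnot
    obtain ⟨M, Γ, g, hM, hP, hΓ, hg⟩ :=
      exists_dual_certificate (fun j => (hΨ j).1) (fun j => (hΦ j).1) hnot
    obtain ⟨Λ, Γ', g', hΛ, hmaj, hlt⟩ :=
      exists_channels_majorizes (fun j => (hΨ j).2) (fun j => (hΦ j).2) hM hP hΓ hg
    exact (h Λ hΛ).not_gt (hMinExt_mixMap_lt hn hΨ hΦ hΛ hmaj hlt)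

end Completeness

/-! ### Marginals of tripartite mixtures -/

section Marginals

variable {n : ℕ} {a0 a1 b0 b1 r0 r1 : Type*} [Fintype a0] [DecidableEq a0]
  [Fintype b0] [DecidableEq b0] [Fintype r0] [DecidableEq r0]

omit [Fintype b0] [DecidableEq b0] in
theorem tensorMap_kronecker (Ψ : LinMap a0 a1) (Φ : LinMap b0 b1) (X : Op a0) (Y : Op b0) :
    tensorMap Ψ Φ (X ⊗ₖ Y) = Ψ X ⊗ₖ Φ Y := by
  ext ⟨k, k'⟩ ⟨l, l'⟩
  have hb (i j : a0) : block (X ⊗ₖ Y) i j = X i j • Y := rfl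
  simp only [tensorMap, LinearMap.coe_mk, AddHom.coe_mk, hb, map_smul, Matrix.sum_apply,
    Matrix.kronecker_apply, Matrix.smul_apply, smul_eq_mul]
  rw [linMap_apply_eq Ψ X, Finset.sum_mul]
  refine Finset.sum_congr rfl fun i _ => ?_
  rw [Finset.sum_mul]
  refine Finset.sum_congr rfl fun j _ => ?_
  rw [choi_apply]
  ring

theorem choi_mixMap (Ψ : Fin n → LinMap a0 a1) (Λ : Fin n → LinMap r0 r1)
    (x y : (a0 × r0) × (a1 × r1)) :
    choi (mixMap Ψ Λ) x y = 1 / (n : ℂ) * ∑ j, Ψ j (Matrix.single x.1.1 y.1.1 1) x.2.1 y.2.1 *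
      Λ j (Matrix.single x.1.2 y.1.2 1) x.2.2 y.2.2 := by
  obtain ⟨⟨α, ρ⟩, κ, r⟩ := x
  obtain ⟨⟨α', ρ'⟩, κ', r'⟩ := y
  simp only [mixMap, choi_smul, choi_sum, Matrix.smul_apply, Matrix.sum_apply, choi_tensorMap,
    smul_eq_mul]
  simp only [choi_apply]

/-- Each `Φⱼ(τ)` has trace 1, so the discarded factor leaves no trace of `τ`. -/
theorem marginalAR_mixABR [Fintype b1] {Ψ : Fin n → LinMap a0 a1} {Φ : Fin n → LinMap b0 b1}
    {Λ : Fin n → LinMap r0 r1} (hΦ : ∀ j, IsTP (Φ j)) {τ : Op b0} (hτ : τ.trace = 1) :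
    marginalAR τ (mixABR Ψ Φ Λ) = mixMap Ψ Λ := by
  refine choi_injective ?_
  ext x y
  have hf : feedB τ (Matrix.single x.1 y.1 1) =
      (Matrix.single x.1.1 y.1.1 1 ⊗ₖ τ) ⊗ₖ Matrix.single x.1.2 y.1.2 1 := by
    ext ⟨⟨s₁, s₂⟩, s₃⟩ ⟨⟨t₁, t₂⟩, t₃⟩
    simp only [feedB, Matrix.of_apply, Matrix.single_apply, Matrix.kronecker_apply, Prod.ext_iff]
    split_ifs <;> simp_all
  rw [choi_mixMap, choi_apply']
  simp only [marginalAR, mixABR, LinearMap.coe_mk, AddHom.coe_mk, Matrix.of_apply, hf,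
    LinearMap.smul_apply, LinearMap.sum_apply, tensorMap_kronecker, Matrix.smul_apply,
    Matrix.sum_apply, Matrix.kronecker_apply, smul_eq_mul, ← Finset.mul_sum]
  congr 1
  rw [Finset.sum_comm]
  refine Finset.sum_congr rfl fun j _ => ?_
  have h1 : ∑ k, Φ j τ k k = 1 := (hΦ j τ).trans hτ
  rw [← Finset.sum_mul, ← Finset.mul_sum, h1, mul_one]

theorem marginalBR_mixABR [Fintype a1] {Ψ : Fin n → LinMap a0 a1} {Φ : Fin n → LinMap b0 b1}
    {Λ : Fin n → LinMap r0 r1} (hΨ : ∀ j, IsTP (Ψ j)) {σ : Op a0} (hσ : σ.trace = 1) :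
    marginalBR σ (mixABR Ψ Φ Λ) = mixMap Φ Λ := by
  refine choi_injective ?_
  ext x y
  have hf : feedA σ (Matrix.single x.1 y.1 1) =
      (σ ⊗ₖ Matrix.single x.1.1 y.1.1 1) ⊗ₖ Matrix.single x.1.2 y.1.2 1 := by
    ext ⟨⟨s₁, s₂⟩, s₃⟩ ⟨⟨t₁, t₂⟩, t₃⟩
    simp only [feedA, Matrix.of_apply, Matrix.single_apply, Matrix.kronecker_apply, Prod.ext_iff]
    split_ifs <;> simp_all
  rw [choi_mixMap, choi_apply']
  simp only [marginalBR, mixABR, LinearMap.coe_mk, AddHom.coe_mk, Matrix.of_apply, hf,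
    LinearMap.smul_apply, LinearMap.sum_apply, tensorMap_kronecker, Matrix.smul_apply,
    Matrix.sum_apply, Matrix.kronecker_apply, smul_eq_mul, ← Finset.mul_sum]
  congr 1
  rw [Finset.sum_comm]
  refine Finset.sum_congr rfl fun j _ => ?_
  have h1 : ∑ k, Ψ j σ k k = 1 := (hΨ j σ).trans hσ
  rw [← Finset.sum_mul, ← Finset.sum_mul, h1, one_mul]

theorem channelDiv_eq [Fintype a1] [DecidableEq a1] [DecidableEq r1] (Λ₁ Λ₂ : LinMap r0 r1)
    (Ψ₁ Ψ₂ : LinMap a0 a1) :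
    channelDiv Λ₁ Λ₂ Ψ₁ Ψ₂ = - hMinExt (mixMap ![Ψ₁, Ψ₂] ![Λ₁, Λ₂]) := by
  simp [channelDiv, mixMap, Fin.sum_univ_two]

end Marginals

end

/-- Systems `A = (a0, a1)`, `B = (b0, b1)`, `C = (c0, c1)`; the reference system `R` is a copy
of `B`, so that the channels of `R` are maps `Op b0 → Op b1`. -/
theorem corollary6 {a0 a1 b0 b1 c0 c1 : Type*}
    [Fintype a0] [DecidableEq a0] [Nonempty a0] [Fintype a1] [DecidableEq a1] [Nonempty a1]
    [Fintype b0] [DecidableEq b0] [Nonempty b0] [Fintype b1] [DecidableEq b1] [Nonempty b1]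
    [Fintype c0] [DecidableEq c0] [Nonempty c0] [Fintype c1] [DecidableEq c1] [Nonempty c1] :
    -- a superchannel exists iff the min-entropy inequality holds for all `Λ₁, …, Λₙ`,
    -- whatever states are fed into the unused inputs in the two marginals
    (∀ (n : ℕ), 0 < n → ∀ (Ψ : Fin n → LinMap a0 a1) (Φ : Fin n → LinMap b0 b1),
      (∀ j, IsChannel (Ψ j)) → (∀ j, IsChannel (Φ j)) →
      ∀ (σ : Op a0) (τ : Op b0), IsDensity σ → IsDensity τ →
      ((∃ Θ : SuperMap a0 a1 b0 b1, IsSuperchannel Θ ∧ ∀ j, Φ j = Θ (Ψ j)) ↔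
        ∀ Λ : Fin n → LinMap b0 b1, (∀ j, IsChannel (Λ j)) →
          hMinExt (marginalAR τ (mixABR Ψ Φ Λ)) ≤ hMinExt (marginalBR σ (mixABR Ψ Φ Λ)))) ∧
    -- each `C_Λ` is contractive under superchannels
    (∀ (Λ₁ Λ₂ : LinMap b0 b1), IsChannel Λ₁ → IsChannel Λ₂ →
      ∀ (Ψ₁ Ψ₂ : LinMap a0 a1), IsChannel Ψ₁ → IsChannel Ψ₂ →
      ∀ Θ : SuperMap a0 a1 c0 c1, IsSuperchannel Θ →
        channelDiv Λ₁ Λ₂ (Θ Ψ₁) (Θ Ψ₂) ≤ channelDiv Λ₁ Λ₂ Ψ₁ Ψ₂) ∧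
    -- for `n = 2` the family `C_Λ` is complete
    (∀ (Ψ₁ Ψ₂ : LinMap a0 a1) (Φ₁ Φ₂ : LinMap b0 b1),
      IsChannel Ψ₁ → IsChannel Ψ₂ → IsChannel Φ₁ → IsChannel Φ₂ →
      ((∃ Θ : SuperMap a0 a1 b0 b1, IsSuperchannel Θ ∧ Φ₁ = Θ Ψ₁ ∧ Φ₂ = Θ Ψ₂) ↔
        ∀ Λ₁ Λ₂ : LinMap b0 b1, IsChannel Λ₁ → IsChannel Λ₂ →
          channelDiv Λ₁ Λ₂ Φ₁ Φ₂ ≤ channelDiv Λ₁ Λ₂ Ψ₁ Ψ₂)) := by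
  refine ⟨fun n hn Ψ Φ hΨ hΦ σ τ hσ hτ => ?_, fun Λ₁ Λ₂ hΛ₁ hΛ₂ Ψ₁ Ψ₂ hΨ₁ hΨ₂ Θ hΘ => ?_,
    fun Ψ₁ Ψ₂ Φ₁ Φ₂ hΨ₁ hΨ₂ hΦ₁ hΦ₂ => ?_⟩
  · simp_rw [marginalAR_mixABR (fun j => (hΦ j).2) hτ.2,
      marginalBR_mixABR (fun j => (hΨ j).2) hσ.2]
    exact exists_superchannel_iff_hMinExt_le hn hΨ hΦ
  · have h := hMinExt_mixMap_le_map two_pos (Ψ := ![Ψ₁, Ψ₂]) (Λ := ![Λ₁, Λ₂])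
      (Fin.forall_fin_two.2 ⟨hΨ₁, hΨ₂⟩) (Fin.forall_fin_two.2 ⟨hΛ₁, hΛ₂⟩) hΘ
    have hv : (fun j : Fin 2 => Θ ((![Ψ₁, Ψ₂] : Fin 2 → LinMap a0 a1) j)) = ![Θ Ψ₁, Θ Ψ₂] := by
      funext j
      fin_cases j <;> rfl
    rw [channelDiv_eq, channelDiv_eq]
    exact neg_le_neg (hv ▸ h)
  · have h := exists_superchannel_iff_hMinExt_le two_pos (Ψ := ![Ψ₁, Ψ₂]) (Φ := ![Φ₁, Φ₂])
      (Fin.forall_fin_two.2 ⟨hΨ₁, hΨ₂⟩) (Fin.forall_fin_two.2 ⟨hΦ₁, hΦ₂⟩)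
    simp only [Fin.forall_fin_two, Matrix.cons_val_zero, Matrix.cons_val_one] at h
    rw [h]
    simp_rw [channelDiv_eq, neg_le_neg_iff]
    refine ⟨fun h' Λ₁ Λ₂ h₁ h₂ => h' ![Λ₁, Λ₂] ⟨h₁, h₂⟩, fun h' Λ hΛ => ?_⟩
    have hv : Λ = ![Λ 0, Λ 1] := by
      funext j
      fin_cases j <;> rfl
    rw [hv]
    exact h' _ _ hΛ.1 hΛ.2
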